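/- Let $N\ge 1$ and write $N=2n$ or $N=2n+1$; let $l\ge 1$. **Brauer algebra.** Let $\mathcal B_m(\omega)$ be the Brauer algebra over $\mathbb C(\omega)$, with basis the $m$-diagrams (perfect matchings of two rows of $m$ dots); a product $d_1d_2$ is obtained by placing $d_1$ above $d_2$, and each closed loop is replaced by a factor $\omega$. For $a<b$ let $s_{ab}$ be the diagram of the transposition $(a\,b)$, and let $\epsilon_{ab}$ be the diagram in which the dots $a,b$ are joined in each of the two rows and all other edges are vertical. Put $x_b=\frac{\omega-1}{2}+\sum_{a<b}(s_{ab}-\epsilon_{ab})$ for $1\le b\le m$. **Symmetrizer.** The symmetrizer $S^{(m)}\in\mathcal B_m(\omega)$ is the primitive idempotent attached to the unique standard tableau of row shape $(m)$. It is defined by $S^{(0)}=1$ and $$S^{(m)}=S^{(m-1)}\,\frac{u-c_m}{u-x_m}\Big|_{u=c_m},\qquad c_m=\frac{\omega-1}{2}+m-1,$$ where $\mathcal B_{m-1}(\omega)$ is regarded as a subalgebra of $\mathcal B_m(\omega)$ by adding a vertical edge on the right, and the rational function of $u$ is evaluated at $u=c_m$, where it is regular. **Characteristic map (orthogonal case).**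 Put $i'=N-i+1$. The algebra $\mathcal B_m(N)$ acts on $(\mathbb C^N)^{\otimes m}$ by letting $s_{ab}$ act as $\sum_{i,j}e_{ij}\otimes e_{ji}$ and $\epsilon_{ab}$ as $\sum_{i,j}e_{ij}\otimes e_{i'j'}$ in the tensor factors $a,b$. Let $Y=\operatorname{diag}(y_1,\dots,y_n,-y_n,\dots,-y_1)$ if $N=2n$, and $Y=\operatorname{diag}(y_1,\dots,y_n,0,-y_n,\dots,-y_1)$ if $N=2n+1$. For $C\in\mathcal B_m(N)$ set $$\operatorname{ch}(C)=\frac1{m!}\operatorname{tr}\big(C\,Y_1\cdots Y_m\big)\in\mathbb C[y_1,\dots,y_n],$$ where $Y_a$ denotes $Y$ acting in the $a$-th tensor factor and the trace is taken over $(\mathbb C^N)^{\otimes m}$. **Statement.** The symmetrizer $S^{(2l)}\in\mathcal B_{2l}(\omega)$ exists and is uniquely determined by the recurrence, its coefficients in the basis of diagrams are regular at $\omega=N$, and its specialization $S^{(2l)}\in\mathcal B_{2l}(N)$ at $\omega=N$ satisfies $$\operatorname{ch}\big(S^{(2l)}\big)=\frac{N+4l-2}{(2l)!\,(N+2l-2)}\,h_l(y_1^2,\dots,y_n^2)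 =\frac{N+4l-2}{(2l)!\,(N+2l-2)}\sum_{1\le i_1\le\dots\le i_l\le n}y_{i_1}^2\cdots y_{i_l}^2 .$$ -/

import Mathlib

open Polynomial

noncomputable section

/-- The `2m` dots of an `m`-diagram: `Sum.inl k` is the `k`-th dot of the top row and
`Sum.inr k` is the `k`-th dot of the bottom row. -/
abbrev BrauerDots (m : ℕ) : Type := Fin m ⊕ Fin m

/-- An `m`-diagram: a perfect matching of the `2m` dots, given by the map sending each dot to
the other end of its edge. -/
abbrev BrauerDiagram (m : ℕ) : Type :=
  {d : BrauerDots m → BrauerDots m // ∀ v, d v ≠ v ∧ d (d v) = v}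

namespace BrauerDiagram

variable {m : ℕ}

/-- The identity diagram: every top dot is joined to the bottom dot below it. -/
def identity (m : ℕ) : BrauerDiagram m :=
  ⟨Sum.swap, fun v => by cases v <;> simp⟩

/-- The diagram `s_{ab}` of the transposition `(a b)`. -/
def transposition (a b : Fin m) : BrauerDiagram m :=
  ⟨Sum.elim (fun k => Sum.inr (Equiv.swap a b k)) (fun k => Sum.inl (Equiv.swap a b k)),
    fun v => by cases v <;> simp⟩

/-- The diagram `ε_{ab}`: dots `a` and `b` of the top row are joined, dots `a` and `b` of the
bottom row are joined, and all other edges are vertical. -/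
def contraction (a b : Fin m) (hab : a ≠ b) : BrauerDiagram m :=
  ⟨Sum.elim
      (fun k => if k = a then Sum.inl b else if k = b then Sum.inl a else Sum.inr k)
      (fun k => if k = a then Sum.inr b else if k = b then Sum.inr a else Sum.inl k), by
    intro v
    rcases v with k | k <;> by_cases h1 : k = a <;> by_cases h2 : k = b <;>
      simp_all [hab.symm]⟩

/-- Adding one more vertical edge on the right. -/
def extend (d : BrauerDiagram m) : BrauerDiagram (m + 1) :=
  ⟨Sum.elim
      (Fin.lastCases (Sum.inr (Fin.last m))
        (fun k => Sum.map Fin.castSucc Fin.castSucc (d.1 (Sum.inl k))))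
      (Fin.lastCases (Sum.inl (Fin.last m))
        (fun k => Sum.map Fin.castSucc Fin.castSucc (d.1 (Sum.inr k)))), by
    have key : ∀ w : BrauerDots m,
        Sum.elim
          (Fin.lastCases (Sum.inr (Fin.last m))
            (fun k => Sum.map Fin.castSucc Fin.castSucc (d.1 (Sum.inl k))))
          (Fin.lastCases (Sum.inl (Fin.last m))
            (fun k => Sum.map Fin.castSucc Fin.castSucc (d.1 (Sum.inr k))))
          (Sum.map Fin.castSucc Fin.castSucc w) =
        (Sum.map Fin.castSucc Fin.castSucc (d.1 w) : BrauerDots (m + 1)) := by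
      intro w
      cases w <;> simp
    have inj : Function.Injective
        (Sum.map Fin.castSucc Fin.castSucc : BrauerDots m → BrauerDots (m + 1)) :=
      Sum.map_injective.2 ⟨Fin.castSucc_injective m, Fin.castSucc_injective m⟩
    rintro (k | k)
    · refine Fin.lastCases ?_ (fun k => ?_) k
      · simp
      · have h := d.2 (Sum.inl k)
        have e := key (Sum.inl k)
        rw [Sum.map_inl] at e
        rw [e, key, h.2]
        exact ⟨fun h' => h.1 (inj h'), rfl⟩
    · refine Fin.lastCases ?_ (fun k => ?_) k
      · simp
      · have h := d.2 (Sum.inr k)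
        have e := key (Sum.inr k)
        rw [Sum.map_inr] at e
        rw [e, key, h.2]
        exact ⟨fun h' => h.1 (inj h'), rfl⟩⟩

/-- The dots of two diagrams placed one above the other, the bottom row of the upper diagram
being identified with the top row of the lower one. The three summands are the top row, the
middle row and the bottom row. -/
abbrev StackDots (m : ℕ) : Type := Fin m ⊕ (Fin m ⊕ Fin m)

/-- The dots of the upper diagram of the stack. -/
def upper : BrauerDots m → StackDots m := Sum.elim Sum.inl (fun k => Sum.inr (Sum.inl k))

/-- The dots of the lower diagram of the stack. -/
def lower : BrauerDots m → StackDots m := Sum.inr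

/-- The dots of the outer rows (top and bottom) of the stack. -/
def outer : BrauerDots m → StackDots m := Sum.elim Sum.inl (fun k => Sum.inr (Sum.inr k))

/-- The graph obtained by placing `d₁` above `d₂`. -/
def stack (d₁ d₂ : BrauerDiagram m) : SimpleGraph (StackDots m) :=
  SimpleGraph.fromRel fun v w =>
    (∃ x, v = upper x ∧ w = upper (d₁.1 x)) ∨ (∃ x, v = lower x ∧ w = lower (d₂.1 x))

/-- The number of closed loops of the stack: the connected components which contain only dots
of the middle row. -/
def loops (d₁ d₂ : BrauerDiagram m) : ℕ :=
  Nat.card {c : (stack d₁ d₂).ConnectedComponent //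
    ∀ v ∈ c.supp, ∃ k : Fin m, v = Sum.inr (Sum.inl k)}

/-- `d` is the diagram obtained by placing `d₁` above `d₂` and discarding the loops: the ends of
each edge of `d` are the ends of a path of the stack. -/
def IsStacking (d₁ d₂ d : BrauerDiagram m) : Prop :=
  ∀ x, (stack d₁ d₂).Reachable (outer x) (outer (d.1 x))

end BrauerDiagram

/-- The Brauer algebra `B_m(ω)` over `R`: the free `R`-module on the `m`-diagrams (an element is
its family of coefficients) with the multiplication defined below. -/
def BrauerAlgebra (R : Type) [CommRing R] (_ω : R) (m : ℕ) : Type := BrauerDiagram m → R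

namespace BrauerAlgebra

variable {R : Type} [CommRing R] {ω : R} {m : ℕ}

instance : AddCommGroup (BrauerAlgebra R ω m) :=
  inferInstanceAs (AddCommGroup (BrauerDiagram m → R))

instance : Module R (BrauerAlgebra R ω m) :=
  inferInstanceAs (Module R (BrauerDiagram m → R))

/-- The basis element given by a diagram. -/
def ofDiagram (d : BrauerDiagram m) : BrauerAlgebra R ω m :=
  (Pi.single d 1 : BrauerDiagram m → R)

instance : One (BrauerAlgebra R ω m) := ⟨ofDiagram (BrauerDiagram.identity m)⟩

open Classical in
/-- The bilinear multiplication with `d₁ * d₂ = ω ^ (number of loops) • d`, where `d` is the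
diagram obtained by placing `d₁` above `d₂` and discarding the loops. -/
instance : Mul (BrauerAlgebra R ω m) :=
  ⟨fun f g d => ∑ d₁ : BrauerDiagram m, ∑ d₂ : BrauerDiagram m,
    if BrauerDiagram.IsStacking d₁ d₂ d then f d₁ * g d₂ * ω ^ BrauerDiagram.loops d₁ d₂ else 0⟩

/-- The natural embedding of `B_m(ω)` into `B_{m+1}(ω)`. -/
def incl (f : BrauerAlgebra R ω m) : BrauerAlgebra R ω (m + 1) :=
  ∑ d : BrauerDiagram m, f d • ofDiagram d.extend

variable {K : Type} [Field K]

/-- The Jucys--Murphy element `x_b = (ω - 1)/2 + ∑_{a < b} (s_{ab} - ε_{ab})`. -/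
def jucysMurphy (ω : K) (b : Fin m) : BrauerAlgebra K ω m :=
  ((ω - 1) / 2) • (1 : BrauerAlgebra K ω m) +
    ∑ a : {a : Fin m // a < b},
      (ofDiagram (BrauerDiagram.transposition a.1 b) -
        ofDiagram (BrauerDiagram.contraction a.1 b a.2.ne))

/-- An element of the Brauer algebra over `K`, regarded as a constant polynomial in `u` with
coefficients in the Brauer algebra. -/
def const {ω : K} (f : BrauerAlgebra K ω m) : BrauerAlgebra K[X] (C ω) m :=
  fun d => C (f d)

/-- The value at `u = c` of a polynomial in `u` with coefficients in the Brauer algebra. -/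
def evalAt {ω : K} (c : K) (P : BrauerAlgebra K[X] (C ω) m) : BrauerAlgebra K ω m :=
  fun d => (P d).eval c

/-- `E` is the value at `u = c` of the rational function `A (u - c) (u - x)⁻¹` of `u`.
Here this rational function is written as `P(u) / q(u)`, where the polynomial `P` has
coefficients in the Brauer algebra and the scalar polynomial `q` does not vanish at `c`. -/
def IsValueOfFraction {ω : K} (A x : BrauerAlgebra K ω m) (c : K)
    (E : BrauerAlgebra K ω m) : Prop :=
  ∃ (q : K[X]) (P : BrauerAlgebra K[X] (C ω) m),
    q.eval c ≠ 0 ∧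
    P * ((X : K[X]) • (1 : BrauerAlgebra K[X] (C ω) m) - const x) =
      (q * (X - C c)) • const A ∧
    E = (q.eval c)⁻¹ • evalAt c P

/-- `E` is the primitive idempotent `E_T` of `B_m(ω)`, where the standard tableau `T` with `m`
boxes is given by its sequence of boxes: `T r` is the box (row, column), counted from zero, added
at step `r` (only `T 0, …, T (m - 1)` matter). The definition is the recurrence
`E_T = E_U (u - c_m) / (u - x_m)` at `u = c_m`, where `U` is `T` without its last box and
`c_m = (ω - 1)/2 + column - row` is the content of that box. -/
def IsPrimitiveIdempotent (ω : K) (T : ℕ → ℕ × ℕ) : (m : ℕ) → BrauerAlgebra K ω m → Prop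
  | 0, E => E = 1
  | m + 1, E => ∃ F : BrauerAlgebra K ω m, IsPrimitiveIdempotent ω T m F ∧
      IsValueOfFraction (incl F) (jucysMurphy ω (Fin.last m))
        ((ω - 1) / 2 + ((T m).2 : K) - ((T m).1 : K)) E

/-- `S` is the symmetrizer `S^{(m)}` of the Brauer algebra `B_m(ω)` over `ℂ(ω)`, that is, the
idempotent `E_T` for the unique standard tableau `T` of the row shape `(m)`. -/
def IsSymmetrizer (m : ℕ) (S : BrauerAlgebra (RatFunc ℂ) RatFunc.X m) : Prop :=
  IsPrimitiveIdempotent RatFunc.X (fun r => (0, r)) m S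

/-- All coefficients of an element of `B_m(ω)` are regular at `ω = z`. -/
def IsRegularAt (z : ℂ) (S : BrauerAlgebra (RatFunc ℂ) RatFunc.X m) : Prop :=
  ∀ d, (S d).denom.eval z ≠ 0

/-- The specialization `ω = z`. -/
def specialize (z : ℂ) (S : BrauerAlgebra (RatFunc ℂ) RatFunc.X m) : BrauerAlgebra ℂ z m :=
  fun d => (S d).eval (RingHom.id ℂ) z

/-- The action of an `m`-diagram in the tensor power `(ℂ^N)^{⊗m}` equipped with the basis
`e_{I 0} ⊗ ⋯ ⊗ e_{I (m-1)}`. The entry in row `I` and column `J` is `1` if, after labelling the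
dots of the top row by `I` and the dots of the bottom row by `J`, the ends of each edge between
the two rows have equal labels and the ends `i`, `j` of each edge inside a row satisfy
`j = i' = N - i + 1` (which is `Fin.rev i` when counting from zero); otherwise it is `0`. Thus
`s_{ab}` acts by `∑ e_{ij} ⊗ e_{ji}` and `ε_{ab}` by `∑ e_{ij} ⊗ e_{i'j'}` in the tensor
factors `a` and `b`. -/
def diagramMatrix (N : ℕ) (d : BrauerDiagram m) :
    Matrix (Fin m → Fin N) (Fin m → Fin N) ℂ :=
  fun I J =>
    if ∀ v : BrauerDots m,
        Sum.elim I J (d.1 v) =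
          if (d.1 v).isLeft = v.isLeft then Fin.rev (Sum.elim I J v) else Sum.elim I J v
    then 1 else 0

/-- The action of the Brauer algebra `B_m(N)` in the tensor power `(ℂ^N)^{⊗m}`. -/
def action (N : ℕ) (f : BrauerAlgebra ℂ (N : ℂ) m) :
    Matrix (Fin m → Fin N) (Fin m → Fin N) ℂ :=
  ∑ d : BrauerDiagram m, f d • diagramMatrix N d

/-- The diagonal matrix `diag(y_1, …, y_n, -y_n, …, -y_1)` for `N = 2n` and
`diag(y_1, …, y_n, 0, -y_n, …, -y_1)` for `N = 2n + 1`, with indeterminate entries. -/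
def cartanMatrix (N n : ℕ) : Matrix (Fin N) (Fin N) (MvPolynomial (Fin n) ℂ) :=
  Matrix.diagonal fun i =>
    if h : (i : ℕ) < n then MvPolynomial.X ⟨i, h⟩
    else if h : (Fin.rev i : ℕ) < n then -MvPolynomial.X ⟨Fin.rev i, h⟩
    else 0

/-- The operator `Y_1 ⋯ Y_m = Y ⊗ ⋯ ⊗ Y`. -/
def tensorPower {A : Type} [CommRing A] {N : ℕ} (m : ℕ) (Y : Matrix (Fin N) (Fin N) A) :
    Matrix (Fin m → Fin N) (Fin m → Fin N) A :=
  fun I J => ∏ a, Y (I a) (J a)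

/-- The characteristic map in the orthogonal case: `C ↦ (1 / m!) tr (C Y_1 ⋯ Y_m)`, a polynomial
in `y_1, …, y_n`. -/
def characteristicMap (N n : ℕ) (f : BrauerAlgebra ℂ (N : ℂ) m) : MvPolynomial (Fin n) ℂ :=
  MvPolynomial.C (1 / (m.factorial : ℂ)) *
    ((action N f).map MvPolynomial.C * tensorPower m (cartanMatrix N n)).trace

end BrauerAlgebra

end

/-!
The coefficient of a diagram in the symmetrizer `S^{(m)}` depends only on the number `r` of
horizontal edges in one of its rows: it is `(1/m!) (-1)^r` divided by the binomial coefficient of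
`ω/2 + m - 2` over `r` (`symmetrizerCoeff`). To see that this element satisfies the recurrence, one
describes the right multiplication by the last Jucys--Murphy element `x` (`mulJucysMurphy`). Put
`h = (ω - 1)/2`. The coefficient of `d` in `f x` is `h f(d)` plus the sum of the coefficients in `f`
of the diagrams that arise from `d` by exchanging the last bottom dot with another bottom dot, if
the last bottom dot is joined to the top row in `d`; otherwise it is `-h f(d)` minus the
corresponding sum over the exchanges of the last bottom dot with the top dots. Then `S^{(m+1)}` is
an eigenvector of `x` with the eigenvalue `h + m`, and the image `A` of `S^{(m)}` together with `x A`
and `S^{(m+1)}` spans an `x`-stable space: `A` is the sum of `S^{(m+1)}` and of eigenvectors with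
the eigenvalues `h - 1` and `-(h + m - 1)`. Hence `A (u - c) (u - x)⁻¹` takes the value `S^{(m+1)}`
at `u = c = h + m` (`isValueOfFraction_symmetrizer`). The value is unique because `u - x` is not a
right zero divisor (`eq_zero_of_X_smul_eq`).

The trace of `d Y_1 ⋯ Y_m` is a sum over the labellings of the columns of `d`. By Wick's theorem
(`expect_prod_X`), the generating function of these traces, with a factor `s` for each bottom dot
on a horizontal edge, is the Gaussian expectation of the power `(∑_i Y_i u_i v_i)^m`, where the
variables `u_i` and `v_i` of the top and the bottom dots have the covariances `E(u_i u_{i'}) = 1`,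
`E(u_i v_i) = 1` and `E(v_i v_{i'}) = s²`. This sum is `∑_j y_j q_j` with independent quadratic
forms `q_j = u_j v_j - u_{j'} v_{j'}`, whose moments are `E(q_j^{2k}) = (2k)! (1 - s²)^k`, the odd
ones being zero (`expect_pairForm_pow`). So the generating function for `m = 2l` is
`(2l)! (1 - s²)^l h_l(y_1², …, y_n²)` (`sum_X_pow_mul_diagramTrace_eq`). Replacing `s^{2r}` by the
coefficients of the symmetrizer leaves the sum of the binomial coefficients of `l` divided
by the binomial coefficients of `N/2 + 2l - 2`, which telescopes to `(N + 4l - 2)/(N + 2l - 2)`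
(`sum_choose_mul_symmetrizerCoeff`).
-/

noncomputable section

/-! ### Placing a transposition or a contraction below a diagram -/

namespace BrauerDiagram

variable {m : ℕ}

/-- The diagram obtained from `d` by moving its dots along the permutation `τ`; as an involution
it is the conjugate of `d` by `τ`. -/
def conj (τ : Equiv.Perm (BrauerDots m)) (d : BrauerDiagram m) : BrauerDiagram m :=
  ⟨fun v => τ (d.1 (τ.symm v)), fun v => by
    have h := d.2 (τ.symm v)
    exact ⟨fun e => h.1 (by rw [Equiv.eq_symm_apply]; exact e), by simp [h.2]⟩⟩

lemma conj_apply (τ : Equiv.Perm (BrauerDots m)) (d : BrauerDiagram m) (v : BrauerDots m) :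
    (conj τ d).1 v = τ (d.1 (τ.symm v)) := rfl

lemma conj_swap_apply (p q : BrauerDots m) (d : BrauerDiagram m) (v : BrauerDots m) :
    (conj (Equiv.swap p q) d).1 v = Equiv.swap p q (d.1 (Equiv.swap p q v)) := rfl

lemma conj_swap_conj_swap (p q : BrauerDots m) (d : BrauerDiagram m) :
    conj (Equiv.swap p q) (conj (Equiv.swap p q) d) = d := by
  ext v : 2
  simp [conj_swap_apply]

lemma conj_swap_self (p : BrauerDots m) (d : BrauerDiagram m) :
    conj (Equiv.swap p p) d = d := by
  ext v : 2
  simp [conj_apply]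

/-- Exchanging the two ends of an edge does not change a diagram. -/
lemma conj_swap_edge (p : BrauerDots m) (d : BrauerDiagram m) :
    conj (Equiv.swap (d.1 p) p) d = d := by
  ext v : 2
  have h := d.2
  rw [conj_swap_apply]
  by_cases h1 : v = p
  · subst h1; simp [h v]
  by_cases h2 : v = d.1 p
  · subst h2; simp [h p]
  · rw [Equiv.swap_apply_of_ne_of_ne h2 h1, Equiv.swap_apply_of_ne_of_ne]
    · intro e; exact h1 (by rw [← (h v).2, e, (h p).2])
    · intro e; exact h2 (by rw [← (h v).2, e])

lemma injective (d : BrauerDiagram m) : Function.Injective d.1 :=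
  (show Function.Involutive d.1 from fun v => (d.2 v).2).injective

lemma apply_apply (d : BrauerDiagram m) (v : BrauerDots m) : d.1 (d.1 v) = v := (d.2 v).2

lemma apply_eq_iff (d : BrauerDiagram m) {v w : BrauerDots m} : d.1 v = w ↔ v = d.1 w :=
  ⟨fun e => by rw [← e, d.apply_apply], fun e => by rw [e, d.apply_apply]⟩

lemma reachable_upper (d₁ d₂ : BrauerDiagram m) (x : BrauerDots m) :
    (stack d₁ d₂).Reachable (upper x) (upper (d₁.1 x)) := by
  by_cases h : upper x = upper (d₁.1 x)
  · rw [← h]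
  · exact SimpleGraph.Adj.reachable ((SimpleGraph.fromRel_adj _ _ _).2
      ⟨h, Or.inl (Or.inl ⟨x, rfl, rfl⟩)⟩)

lemma reachable_lower (d₁ d₂ : BrauerDiagram m) (x : BrauerDots m) :
    (stack d₁ d₂).Reachable (lower x) (lower (d₂.1 x)) := by
  by_cases h : lower x = lower (d₂.1 x)
  · rw [← h]
  · exact SimpleGraph.Adj.reachable ((SimpleGraph.fromRel_adj _ _ _).2
      ⟨h, Or.inl (Or.inr ⟨x, rfl, rfl⟩)⟩)

/-- A reflexive, symmetric and transitive relation that contains the edges of both diagrams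
contains the connectedness relation of the stack. -/
lemma rel_of_reachable {d₁ d₂ : BrauerDiagram m} {r : StackDots m → StackDots m → Prop}
    (hr : Equivalence r) (hu : ∀ x, r (upper x) (upper (d₁.1 x)))
    (hl : ∀ x, r (lower x) (lower (d₂.1 x))) {v w : StackDots m}
    (h : (stack d₁ d₂).Reachable v w) : r v w := by
  obtain ⟨p⟩ := h
  induction p with
  | nil => exact hr.refl _
  | cons hadj _ ih =>
    refine hr.trans ?_ ih
    rcases ((SimpleGraph.fromRel_adj _ _ _).1 hadj).2 with
      (⟨x, rfl, rfl⟩ | ⟨x, rfl, rfl⟩) | (⟨x, rfl, rfl⟩ | ⟨x, rfl, rfl⟩)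
    · exact hu x
    · exact hl x
    · exact hr.symm (hu x)
    · exact hr.symm (hl x)

/-- If the stack retracts onto its outer dots in such a way that edges go to points or to edges
of `d₀`, then `d₀` is the only diagram which may arise from the stack. -/
lemma eq_of_isStacking {d₁ d₂ d d₀ : BrauerDiagram m} (π : StackDots m → BrauerDots m)
    (hπ : ∀ x, π (outer x) = x)
    (hu : ∀ x, π (upper (d₁.1 x)) = π (upper x) ∨ π (upper (d₁.1 x)) = d₀.1 (π (upper x)))
    (hl : ∀ x, π (lower (d₂.1 x)) = π (lower x) ∨ π (lower (d₂.1 x)) = d₀.1 (π (lower x)))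
    (h : IsStacking d₁ d₂ d) : d = d₀ := by
  have hr : Equivalence fun v w : StackDots m => π w = π v ∨ π w = d₀.1 (π v) := by
    refine ⟨fun _ => Or.inl rfl, ?_, ?_⟩
    · rintro v w (e | e)
      · exact Or.inl e.symm
      · right; rw [e, d₀.apply_apply]
    · rintro u v w (e | e) (e' | e')
      · left; rw [e', e]
      · right; rw [e', e]
      · right; rw [e', e]
      · left; rw [e', e, d₀.apply_apply]
  ext x : 2
  have := rel_of_reachable hr hu hl (h x)
  simp only [hπ] at this
  exact this.resolve_left (d.2 x).1

lemma loops_eq_zero {d₁ d₂ : BrauerDiagram m}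
    (h : ∀ k : Fin m, ∃ x, (stack d₁ d₂).Reachable (Sum.inr (Sum.inl k)) (outer x)) :
    loops d₁ d₂ = 0 := by
  rw [loops, Nat.card_eq_zero]
  left
  refine ⟨fun ⟨c, hc⟩ => ?_⟩
  induction c using SimpleGraph.ConnectedComponent.ind with
  | _ v =>
  obtain ⟨k, rfl⟩ := hc v rfl
  obtain ⟨x, hx⟩ := h k
  obtain ⟨j, hj⟩ := hc (outer x) (by
    rw [SimpleGraph.ConnectedComponent.mem_supp_iff]
    exact SimpleGraph.ConnectedComponent.sound hx.symm)
  cases x <;> simp [outer] at hj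

section Transposition

variable (d₁ : BrauerDiagram m) (a b : Fin m)

lemma reachable_outer_upper_transposition (x : BrauerDots m) :
    (stack d₁ (transposition a b)).Reachable (outer x)
      (upper (Equiv.swap (Sum.inr a) (Sum.inr b) x)) := by
  rcases x with k | k
  · rw [Equiv.swap_apply_of_ne_of_ne (by simp) (by simp)]
    exact SimpleGraph.Reachable.refl _
  · have e : Equiv.swap (Sum.inr a) (Sum.inr b) (Sum.inr k : BrauerDots m) =
        Sum.inr (Equiv.swap a b k) := by
      simp only [Equiv.swap_apply_def, Sum.inr.injEq]
      split_ifs <;> rfl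
    rw [e]
    exact reachable_lower d₁ (transposition a b) (Sum.inr k)

lemma isStacking_transposition (d : BrauerDiagram m) :
    IsStacking d₁ (transposition a b) d ↔
      d₁ = conj (Equiv.swap (Sum.inr a) (Sum.inr b)) d := by
  have key : IsStacking d₁ (transposition a b) d ↔
      d = conj (Equiv.swap (Sum.inr a) (Sum.inr b)) d₁ := by
    constructor
    · refine eq_of_isStacking
        (Sum.elim Sum.inl (Sum.elim (fun k => Sum.inr (Equiv.swap a b k)) Sum.inr)) ?_ ?_ ?_
      · rintro (k | k) <;> rfl
      · have hs : ∀ x : BrauerDots m, (Sum.elim Sum.inl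
            (Sum.elim (fun k => Sum.inr (Equiv.swap a b k)) Sum.inr) : _ → BrauerDots m)
              (upper x) = Equiv.swap (Sum.inr a) (Sum.inr b) x := by
          rintro (k | k)
          · rw [Equiv.swap_apply_of_ne_of_ne (by simp) (by simp)]; rfl
          · simp only [upper, Sum.elim_inr, Sum.elim_inl, Equiv.swap_apply_def, Sum.inr.injEq]
            split_ifs <;> rfl
        intro x
        right
        rw [hs, hs, conj_swap_apply, Equiv.swap_apply_self]
      · rintro (k | k) <;> left <;> simp [transposition, lower]
    · rintro rfl x
      refine (reachable_outer_upper_transposition d₁ a b x).trans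
        ((reachable_upper d₁ _ _).trans ?_)
      have := reachable_outer_upper_transposition d₁ a b
        ((conj (Equiv.swap (Sum.inr a) (Sum.inr b)) d₁).1 x)
      rw [conj_swap_apply, Equiv.swap_apply_self] at this
      exact this.symm
  rw [key]
  constructor <;> rintro rfl <;> rw [conj_swap_conj_swap]

lemma loops_transposition : loops d₁ (transposition a b) = 0 := by
  refine loops_eq_zero fun k => ⟨Sum.inr (Equiv.swap a b k), ?_⟩
  exact reachable_lower d₁ (transposition a b) (Sum.inl k)

end Transposition

section Contraction

variable (d₁ : BrauerDiagram m) {a b : Fin m} (hab : a ≠ b)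

lemma reachable_outer_upper_contraction {x : BrauerDots m} (ha : x ≠ Sum.inr a)
    (hb : x ≠ Sum.inr b) :
    (stack d₁ (contraction a b hab)).Reachable (outer x) (upper x) := by
  rcases x with k | k
  · exact SimpleGraph.Reachable.refl _
  · have := reachable_lower d₁ (contraction a b hab) (Sum.inr k)
    have e : (contraction a b hab).1 (Sum.inr k) = Sum.inl k := by
      simp only [ne_eq, Sum.inr.injEq] at ha hb
      simp [contraction, ha, hb]
    rw [e] at this
    exact this

lemma reachable_upper_contraction :
    (stack d₁ (contraction a b hab)).Reachable (upper (Sum.inr a)) (upper (Sum.inr b)) := by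
  have := reachable_lower d₁ (contraction a b hab) (Sum.inl a)
  rw [show (contraction a b hab).1 (Sum.inl a) = Sum.inl b by simp [contraction]] at this
  exact this

lemma reachable_outer_contraction :
    (stack d₁ (contraction a b hab)).Reachable (outer (Sum.inr a)) (outer (Sum.inr b)) := by
  have := reachable_lower d₁ (contraction a b hab) (Sum.inr a)
  rw [show (contraction a b hab).1 (Sum.inr a) = Sum.inr b by simp [contraction]] at this
  exact this

/-- Placing `d₁` above `ε_{ab}` connects the partners in `d₁` of the bottom dots `a` and `b`, and
joins `a` to `b`. -/
lemma isStacking_contraction_iff (d : BrauerDiagram m) :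
    IsStacking d₁ (contraction a b hab) d ↔
      d = conj (Equiv.swap (d₁.1 (Sum.inr a)) (Sum.inr b)) d₁ := by
  have hab' : (Sum.inr a : BrauerDots m) ≠ Sum.inr b := by simpa using hab
  have hpa : d₁.1 (Sum.inr a) ≠ Sum.inr a := (d₁.2 _).1
  have hqb : d₁.1 (Sum.inr b) ≠ Sum.inr b := (d₁.2 _).1
  -- `A`, `B` are the bottom dots `a`, `b`, with partners `p`, `q` in `d₁`
  obtain ⟨A, hA⟩ : ∃ A : BrauerDots m, A = Sum.inr a := ⟨_, rfl⟩
  obtain ⟨B, hB⟩ : ∃ B : BrauerDots m, B = Sum.inr b := ⟨_, rfl⟩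
  rw [← hA] at hpa
  rw [← hB] at hqb
  rw [← hA, ← hB] at hab' ⊢
  set d₀ := conj (Equiv.swap (d₁.1 A) B) d₁ with hd₀
  have h0A : d₀.1 A = B := by
    rw [hd₀, conj_swap_apply, Equiv.swap_apply_of_ne_of_ne hpa.symm hab', Equiv.swap_apply_left]
  have h0B : d₀.1 B = A := by rw [← h0A, d₀.apply_apply]
  have h0p : d₁.1 A ≠ B → d₀.1 (d₁.1 A) = d₁.1 B := by
    intro h
    rw [hd₀, conj_swap_apply, Equiv.swap_apply_left, Equiv.swap_apply_of_ne_of_ne _ hqb]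
    exact fun e => hab' (d₁.injective e).symm
  have h0 : ∀ x, x ≠ A → x ≠ B → d₁.1 x ≠ A → d₁.1 x ≠ B → d₀.1 x = d₁.1 x := by
    intro x h1 h2 h3 h4
    rw [hd₀, conj_swap_apply, Equiv.swap_apply_of_ne_of_ne _ h2,
      Equiv.swap_apply_of_ne_of_ne _ h4]
    · exact fun e => h1 (d₁.injective e)
    · exact fun e => h3 (d₁.apply_eq_iff.2 e)
  constructor
  · have hs : ∀ x : BrauerDots m, (Sum.elim Sum.inl
        (Sum.elim (fun k => if k = a then d₁.1 A else if k = b then d₁.1 B else Sum.inr k)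
          Sum.inr) : _ → BrauerDots m) (upper x) =
        if x = A then d₁.1 A else if x = B then d₁.1 B else x := by
      rintro (k | k) <;> simp [upper, hA, hB]
    refine eq_of_isStacking (Sum.elim Sum.inl
        (Sum.elim (fun k => if k = a then d₁.1 A else if k = b then d₁.1 B else Sum.inr k)
          Sum.inr)) ?_ (fun x => ?_) ?_
    · rintro (k | k) <;> rfl
    · rw [hs, hs]
      by_cases hAB : d₁.1 A = B
      · have hBA : d₁.1 B = A := by rw [← hAB, d₁.apply_apply]
        by_cases h1 : x = A
        · subst h1; simp [hAB, hBA, h0B, hab'.symm]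
        by_cases h2 : x = B
        · subst h2; simp [hAB, hBA, h0A, hab'.symm]
        have h3 : d₁.1 x ≠ A := fun e => h2 (by rw [← hAB, ← e, d₁.apply_apply])
        have h4 : d₁.1 x ≠ B := fun e => h1 (by rw [← hBA, ← e, d₁.apply_apply])
        simp [h1, h2, h3, h4, h0 x h1 h2 h3 h4]
      · have hBA : d₁.1 B ≠ A := fun e => hAB (by rw [← e, d₁.apply_apply])
        by_cases h1 : x = A
        · subst h1; simp [hAB, hpa]
        by_cases h2 : x = B
        · subst h2; simp [hBA, hqb, hab'.symm]
        by_cases h3 : d₁.1 x = A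
        · left; simp [h1, h2, h3, ← d₁.apply_eq_iff.1 h3]
        by_cases h4 : d₁.1 x = B
        · left; simp [h1, h2, h4, hab'.symm, ← d₁.apply_eq_iff.1 h4]
        simp [h1, h2, h3, h4, h0 x h1 h2 h3 h4]
    · have hpq : d₁.1 B = d₁.1 A ∨ d₁.1 B = d₀.1 (d₁.1 A) := by
        by_cases hAB : d₁.1 A = B
        · right; rw [hAB, h0B, ← hAB, d₁.apply_apply]
        · right; rw [h0p hAB]
      have hqp : d₁.1 A = d₁.1 B ∨ d₁.1 A = d₀.1 (d₁.1 B) := by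
        rcases hpq with h | h
        · exact Or.inl h.symm
        · right; rw [h, d₀.apply_apply]
      rw [hA, hB] at h0A h0B
      rintro (k | k)
      · by_cases h1 : k = a
        · subst h1; simpa [contraction, lower, hab, hab.symm] using hpq
        by_cases h2 : k = b
        · subst h2; simpa [contraction, lower, hab, hab.symm] using hqp
        · simp [contraction, lower, h1, h2]
      · by_cases h1 : k = a
        · subst h1; right; simp [contraction, lower, h0A]
        by_cases h2 : k = b
        · subst h2; right; simp [contraction, lower, hab.symm, h0B]
        · simp [contraction, lower, h1, h2]
  · intro hd x
    subst hd
    have refl_d₀ : ∀ x, x ≠ A → x ≠ B → (stack d₁ (contraction a b hab)).Reachable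
        (outer x) (upper x) := fun x h1 h2 =>
      reachable_outer_upper_contraction d₁ hab (hA ▸ h1) (hB ▸ h2)
    have hup := reachable_upper_contraction d₁ hab
    have hout := reachable_outer_contraction d₁ hab
    rw [← hA, ← hB] at hup hout
    by_cases h1 : x = A
    · subst h1; rw [h0A]; exact hout
    by_cases h2 : x = B
    · subst h2; rw [h0B]; exact hout.symm
    refine (refl_d₀ x h1 h2).trans ((reachable_upper d₁ _ x).trans ?_)
    by_cases h3 : d₁.1 x = A
    · have hx : x = d₁.1 A := d₁.apply_eq_iff.1 h3
      have hAB : d₁.1 A ≠ B := fun e => h2 (hx.trans e)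
      rw [h3, hx, h0p hAB]
      refine hup.trans ((reachable_upper d₁ _ B).trans (refl_d₀ _ ?_ hqb).symm)
      exact fun e => hAB (by rw [← e, d₁.apply_apply])
    by_cases h4 : d₁.1 x = B
    · have hx : x = d₁.1 B := d₁.apply_eq_iff.1 h4
      have hAB : d₁.1 A ≠ B := fun e => h1 (by rw [hx, ← e, d₁.apply_apply])
      have : d₀.1 x = d₁.1 A := by rw [hx, ← h0p hAB, d₀.apply_apply]
      rw [h4, this]
      exact hup.symm.trans ((reachable_upper d₁ _ A).trans (refl_d₀ _ hpa hAB).symm)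
    · rw [h0 x h1 h2 h3 h4]
      exact (refl_d₀ _ h3 h4).symm

lemma loops_contraction_of_ne (h : d₁.1 (Sum.inr a) ≠ Sum.inr b) :
    loops d₁ (contraction a b hab) = 0 := by
  have h' : d₁.1 (Sum.inr b) ≠ Sum.inr a := fun e => h (by rw [← e, d₁.apply_apply])
  refine loops_eq_zero fun k => ?_
  by_cases h1 : k = a
  · subst h1
    exact ⟨_, (reachable_upper d₁ _ (Sum.inr k)).trans
      (reachable_outer_upper_contraction d₁ hab (d₁.2 _).1 h).symm⟩
  by_cases h2 : k = b
  · subst h2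
    exact ⟨_, (reachable_upper d₁ _ (Sum.inr k)).trans
      (reachable_outer_upper_contraction d₁ hab h' (d₁.2 _).1).symm⟩
  · exact ⟨Sum.inr k, (reachable_outer_upper_contraction d₁ hab (x := Sum.inr k)
      (by simpa using h1) (by simpa using h2)).symm⟩

lemma loops_contraction_of_eq (h : d₁.1 (Sum.inr a) = Sum.inr b) :
    loops d₁ (contraction a b hab) = 1 := by
  have h' : d₁.1 (Sum.inr b) = Sum.inr a := by rw [← h, d₁.apply_apply]
  -- the two middle dots `a` and `b` form a connected component
  have hr : Equivalence fun v w : StackDots m =>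
      (v = Sum.inr (Sum.inl a) ∨ v = Sum.inr (Sum.inl b)) ↔
      (w = Sum.inr (Sum.inl a) ∨ w = Sum.inr (Sum.inl b)) :=
    ⟨fun _ => Iff.rfl, Iff.symm, Iff.trans⟩
  have hu' : ∀ x : BrauerDots m, (upper x = Sum.inr (Sum.inl a) ∨ upper x = Sum.inr (Sum.inl b)) ↔
      (x = Sum.inr a ∨ x = Sum.inr b) := by
    rintro (k | k) <;> simp [upper]
  have closed : ∀ w, (stack d₁ (contraction a b hab)).Reachable (Sum.inr (Sum.inl a)) w →
      w = Sum.inr (Sum.inl a) ∨ w = Sum.inr (Sum.inl b) := by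
    intro w hw
    refine (rel_of_reachable hr (fun x => ?_) (fun x => ?_) hw).1 (Or.inl rfl)
    · rw [hu', hu', d₁.apply_eq_iff, d₁.apply_eq_iff, h, h', or_comm]
    · rcases x with k | k <;> by_cases h1 : k = a <;> by_cases h2 : k = b <;>
        simp [contraction, lower, h1, h2, hab, hab.symm]
  rw [loops, Nat.card_eq_one_iff_unique]
  refine ⟨⟨?_⟩, ⟨⟨(stack d₁ (contraction a b hab)).connectedComponentMk (Sum.inr (Sum.inl a)),
    ?_⟩⟩⟩
  · have all : ∀ c : {c : (stack d₁ (contraction a b hab)).ConnectedComponent //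
        ∀ v ∈ c.supp, ∃ k : Fin m, v = Sum.inr (Sum.inl k)},
        c.1 = (stack d₁ (contraction a b hab)).connectedComponentMk (Sum.inr (Sum.inl a)) := by
      rintro ⟨c, hc⟩
      induction c using SimpleGraph.ConnectedComponent.ind with
      | _ v =>
      obtain ⟨k, rfl⟩ := hc v rfl
      by_cases h1 : k = a
      · simp only [h1]
      by_cases h2 : k = b
      · subst h2
        exact SimpleGraph.ConnectedComponent.sound (reachable_upper_contraction d₁ hab).symm
      · exfalso
        have hx := reachable_outer_upper_contraction d₁ hab (x := Sum.inr k) (by simpa) (by simpa)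
        obtain ⟨j, hj⟩ := hc (outer (Sum.inr k)) (by
          rw [SimpleGraph.ConnectedComponent.mem_supp_iff]
          exact SimpleGraph.ConnectedComponent.sound hx)
        simp [outer] at hj
    intro c c'
    exact Subtype.ext ((all c).trans (all c').symm)
  · intro v hv
    rw [SimpleGraph.ConnectedComponent.mem_supp_iff] at hv
    rcases closed v (SimpleGraph.ConnectedComponent.exact hv).symm with h | h
    · exact ⟨a, h⟩
    · exact ⟨b, h⟩

end Contraction

end BrauerDiagram

/-! ### Right multiplication by the Jucys--Murphy element -/

namespace BrauerAlgebra

open BrauerDiagram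

variable {R : Type} [CommRing R] {ω : R} {m : ℕ}

lemma add_apply (f g : BrauerAlgebra R ω m) (d : BrauerDiagram m) : (f + g) d = f d + g d := rfl

lemma sub_apply (f g : BrauerAlgebra R ω m) (d : BrauerDiagram m) : (f - g) d = f d - g d := rfl

lemma smul_apply (r : R) (f : BrauerAlgebra R ω m) (d : BrauerDiagram m) :
    (r • f) d = r * f d := rfl

lemma sum_apply {ι : Type*} (s : Finset ι) (f : ι → BrauerAlgebra R ω m) (d : BrauerDiagram m) :
    (∑ i ∈ s, f i) d = ∑ i ∈ s, f i d :=
  Finset.sum_apply (M := fun _ => R) d s f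

lemma ofDiagram_apply (d d' : BrauerDiagram m) :
    (ofDiagram d : BrauerAlgebra R ω m) d' = if d' = d then 1 else 0 :=
  Pi.single_apply (M := R) d 1 d'

open Classical in
lemma mul_apply (f g : BrauerAlgebra R ω m) (d : BrauerDiagram m) :
    (f * g) d = ∑ d₁ : BrauerDiagram m, ∑ d₂ : BrauerDiagram m,
      if IsStacking d₁ d₂ d then f d₁ * g d₂ * ω ^ loops d₁ d₂ else 0 := rfl

/-- Multiplication by a fixed element from the left, as a linear map. -/
def mulLeftLinear (f : BrauerAlgebra R ω m) : BrauerAlgebra R ω m →ₗ[R] BrauerAlgebra R ω m where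
  toFun g := f * g
  map_add' g g' := by
    funext d
    simp only [mul_apply, add_apply, mul_add, add_mul, ← Finset.sum_add_distrib, ← ite_add_zero]
  map_smul' r g := by
    funext d
    simp only [mul_apply, smul_apply, RingHom.id_apply, Finset.mul_sum, mul_ite, mul_zero]
    refine Finset.sum_congr rfl fun _ _ => Finset.sum_congr rfl fun _ _ => ?_
    split_ifs
    · ring
    · rfl

lemma mulLeftLinear_apply (f g : BrauerAlgebra R ω m) : mulLeftLinear f g = f * g := rfl

open Classical in
lemma mul_ofDiagram_apply (f : BrauerAlgebra R ω m) (d₂ d : BrauerDiagram m) :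
    (f * (ofDiagram d₂ : BrauerAlgebra R ω m)) d =
      ∑ d₁ : BrauerDiagram m, if IsStacking d₁ d₂ d then f d₁ * ω ^ loops d₁ d₂ else 0 := by
  rw [mul_apply]
  refine Finset.sum_congr rfl fun d₁ _ => ?_
  rw [Finset.sum_eq_single d₂]
  · simp [ofDiagram_apply]
  · intro d' _ h
    simp [ofDiagram_apply, h]
  · simp

lemma mul_transposition_apply (f : BrauerAlgebra R ω m) (a b : Fin m) (d : BrauerDiagram m) :
    (f * (ofDiagram (transposition a b) : BrauerAlgebra R ω m)) d =
      f (conj (Equiv.swap (Sum.inr a) (Sum.inr b)) d) := by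
  simp only [mul_ofDiagram_apply, isStacking_transposition, loops_transposition, pow_zero,
    _root_.mul_one]
  exact Fintype.sum_ite_eq' _ f

/-- The diagrams `d₁` for which `d₁ ε_{ab}` is a multiple of a given diagram `d` joining the bottom
dots `a` and `b` are obtained from `d` by exchanging `b` with any dot `p ≠ a`; the dot `p` is then
the partner of `a` in `d₁`. A loop arises for `p = b` only. -/
lemma mul_contraction_apply (f : BrauerAlgebra R ω m) {a b : Fin m} (hab : a ≠ b)
    (d : BrauerDiagram m) :
    (f * (ofDiagram (contraction a b hab) : BrauerAlgebra R ω m)) d =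
      if d.1 (Sum.inr a) = Sum.inr b then
        ∑ p : BrauerDots m, if p = Sum.inr a then 0 else
          f (conj (Equiv.swap p (Sum.inr b)) d) * (if p = Sum.inr b then ω else 1)
      else 0 := by
  have hab' : (Sum.inr a : BrauerDots m) ≠ Sum.inr b := by simpa using hab
  have hfix : ∀ d₁ : BrauerDiagram m,
      (conj (Equiv.swap (d₁.1 (Sum.inr a)) (Sum.inr b)) d₁).1 (Sum.inr a) = Sum.inr b := by
    intro d₁
    rw [conj_swap_apply, Equiv.swap_apply_of_ne_of_ne (d₁.2 _).1.symm hab', Equiv.swap_apply_left]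
  simp only [mul_ofDiagram_apply, isStacking_contraction_iff]
  split_ifs with h
  · have hd : ∀ p : BrauerDots m, p ≠ Sum.inr a →
        (conj (Equiv.swap p (Sum.inr b)) d).1 (Sum.inr a) = p := by
      intro p hp
      rw [conj_swap_apply, Equiv.swap_apply_of_ne_of_ne hp.symm hab', h, Equiv.swap_apply_right]
    have hite : ∀ (p : BrauerDots m) (x : R), (if p = Sum.inr a then 0 else x) =
        if p ≠ Sum.inr a then x else 0 := fun p x => by split_ifs <;> simp_all
    simp only [hite]
    rw [← Finset.sum_filter, ← Finset.sum_filter]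
    refine Finset.sum_bij' (fun d₁ _ => d₁.1 (Sum.inr a))
      (fun p _ => conj (Equiv.swap p (Sum.inr b)) d) ?_ ?_ ?_ ?_ ?_
    · intro d₁ _
      simpa using (d₁.2 (Sum.inr a)).1
    · intro p hp
      simp only [Finset.mem_filter, Finset.mem_univ, true_and] at hp ⊢
      rw [hd p hp, conj_swap_conj_swap]
    · intro d₁ h₁
      simp only [Finset.mem_filter, Finset.mem_univ, true_and] at h₁
      rw [h₁, conj_swap_conj_swap]
    · intro p hp
      simp only [Finset.mem_filter, Finset.mem_univ, true_and] at hp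
      exact hd p hp
    · intro d₁ h₁
      simp only [Finset.mem_filter, Finset.mem_univ, true_and] at h₁
      have e : conj (Equiv.swap (d₁.1 (Sum.inr a)) (Sum.inr b)) d = d₁ := by
        rw [h₁, conj_swap_conj_swap]
      rw [e]
      split_ifs with h2
      · rw [loops_contraction_of_eq d₁ hab h2, pow_one]
      · rw [loops_contraction_of_ne d₁ hab h2, pow_zero]
  · refine Finset.sum_eq_zero fun d₁ _ => if_neg fun e => h ?_
    rw [e, hfix]

lemma mul_one (f : BrauerAlgebra R ω (m + 1)) : f * 1 = f := by
  funext d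
  have h1 : (1 : BrauerAlgebra R ω (m + 1)) =
      ofDiagram (transposition (Fin.last m) (Fin.last m)) := by
    change ofDiagram (identity (m + 1)) = _
    congr 1
    ext v : 2
    rcases v with k | k <;> simp [identity, transposition]
  rw [h1, mul_transposition_apply, conj_swap_self]

/-- The right multiplication by the Jucys--Murphy element `x_{m+1}` of `B_{m+1}(ω)`, with `h` in
place of `(ω - 1)/2`: see `mul_eq_mulJucysMurphy`. -/
def mulJucysMurphy (h : R) : BrauerAlgebra R ω (m + 1) →ₗ[R] BrauerAlgebra R ω (m + 1) where
  toFun f d :=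
    if (d.1 (Sum.inr (Fin.last m))).isLeft then
      h * f d + ∑ k : Fin m,
        f (conj (Equiv.swap (Sum.inr k.castSucc) (Sum.inr (Fin.last m))) d)
    else
      -h * f d - ∑ k : Fin (m + 1), f (conj (Equiv.swap (Sum.inl k) (Sum.inr (Fin.last m))) d)
  map_add' f g := by
    funext d
    change (if (d.1 (Sum.inr (Fin.last m))).isLeft then _ else _ : R) =
      (if (d.1 (Sum.inr (Fin.last m))).isLeft then _ else _ : R) +
      (if (d.1 (Sum.inr (Fin.last m))).isLeft then _ else _ : R)
    simp only [add_apply, Finset.sum_add_distrib]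
    split_ifs <;> ring
  map_smul' r f := by
    funext d
    change (if (d.1 (Sum.inr (Fin.last m))).isLeft then _ else _ : R) =
      r * (if (d.1 (Sum.inr (Fin.last m))).isLeft then _ else _ : R)
    simp only [smul_apply, ← Finset.mul_sum]
    split_ifs <;> ring

lemma mulJucysMurphy_of_isLeft (h : R) (f : BrauerAlgebra R ω (m + 1))
    {d : BrauerDiagram (m + 1)} (hd : (d.1 (Sum.inr (Fin.last m))).isLeft) :
    mulJucysMurphy h f d = h * f d + ∑ k : Fin m,
      f (conj (Equiv.swap (Sum.inr k.castSucc) (Sum.inr (Fin.last m))) d) :=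
  if_pos hd

lemma mulJucysMurphy_of_isRight (h : R) (f : BrauerAlgebra R ω (m + 1))
    {d : BrauerDiagram (m + 1)} (hd : (d.1 (Sum.inr (Fin.last m))).isRight) :
    mulJucysMurphy h f d = -h * f d -
      ∑ k : Fin (m + 1), f (conj (Equiv.swap (Sum.inl k) (Sum.inr (Fin.last m))) d) :=
  if_neg (by simpa using hd)

lemma sum_lt_last {M : Type*} [AddCommMonoid M] (F : {a : Fin (m + 1) // a < Fin.last m} → M) :
    ∑ a, F a = ∑ k : Fin m, F ⟨k.castSucc, k.castSucc_lt_last⟩ := by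
  refine (Fintype.sum_bijective (fun k : Fin m => (⟨k.castSucc, k.castSucc_lt_last⟩ :
    {a : Fin (m + 1) // a < Fin.last m})) ⟨?_, ?_⟩ _ _ fun _ => rfl).symm
  · intro k k' h
    simpa using h
  · rintro ⟨a, ha⟩
    exact ⟨a.castPred ha.ne, by simp⟩

/-- When the last bottom dot `B` is joined to a bottom dot, the terms `s_{aB}` cancel against the
terms of `ε_{aB}` that exchange `B` with bottom dots. -/
lemma mul_eq_mulJucysMurphy {h : R} (hh : 2 * h = ω - 1) (f : BrauerAlgebra R ω (m + 1)) :
    f * (h • (1 : BrauerAlgebra R ω (m + 1)) +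
      ∑ a : {a : Fin (m + 1) // a < Fin.last m},
        (ofDiagram (transposition a.1 (Fin.last m)) -
          ofDiagram (contraction a.1 (Fin.last m) a.2.ne))) = mulJucysMurphy h f := by
  funext d
  rw [sum_lt_last, ← mulLeftLinear_apply, map_add, map_smul, map_sum]
  simp only [map_sub, mulLeftLinear_apply, mul_one, add_apply, smul_apply, sum_apply, sub_apply,
    mul_transposition_apply, mul_contraction_apply, Finset.sum_sub_distrib]
  rcases hB : d.1 (Sum.inr (Fin.last m)) with k | k
  · rw [mulJucysMurphy_of_isLeft _ _ (by simp [hB]),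
      Finset.sum_eq_zero (s := Finset.univ) (f := fun _ => ite _ _ _), sub_zero]
    intro a _
    refine if_neg fun e => ?_
    rw [d.apply_eq_iff, hB] at e
    simp at e
  · have hk : k ≠ Fin.last m := by
      rintro rfl
      exact (d.2 _).1 hB
    obtain ⟨j, rfl⟩ : ∃ j : Fin m, k = j.castSucc := ⟨k.castPred hk, by simp⟩
    rw [mulJucysMurphy_of_isRight _ _ (by simp [hB]),
      Finset.sum_eq_single (s := Finset.univ) (f := fun _ => ite _ _ _) j]
    · have hj := d.apply_eq_iff.2 hB.symm
      rw [if_pos hj]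
      have hself : conj (Equiv.swap (Sum.inr j.castSucc) (Sum.inr (Fin.last m))) d = d := by
        rw [← hB, conj_swap_edge]
      rw [Fintype.sum_sum_type]
      simp only [reduceCtorEq, if_false, _root_.mul_one]
      rw [Fin.sum_univ_castSucc (n := m) (f := fun x => ite (Sum.inr x = Sum.inr _) _ _),
        if_neg (by simpa using hk.symm), if_pos rfl, conj_swap_self]
      have e1 : ∀ i : Fin m, (if (Sum.inr i.castSucc : BrauerDots (m + 1)) = Sum.inr j.castSucc
          then 0 else f (conj (Equiv.swap (Sum.inr i.castSucc) (Sum.inr (Fin.last m))) d) *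
            (if (Sum.inr i.castSucc : BrauerDots (m + 1)) = Sum.inr (Fin.last m) then ω else 1)) =
          f (conj (Equiv.swap (Sum.inr i.castSucc) (Sum.inr (Fin.last m))) d) -
            if i = j then f d else 0 := by
        intro i
        have : (Sum.inr i.castSucc : BrauerDots (m + 1)) ≠ Sum.inr (Fin.last m) := by
          simp
        by_cases hi : i = j
        · subst hi; simp [hself]
        · simp [hi, this]
      rw [Finset.sum_congr rfl fun i _ => e1 i, Finset.sum_sub_distrib]
      simp only [Finset.sum_ite_eq', Finset.mem_univ, if_true]
      linear_combination f d * hh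
    · intro i _ hi
      refine if_neg fun e => hi ?_
      rw [d.apply_eq_iff, hB] at e
      simpa using e
    · simp

end BrauerAlgebra

/-! ### The number of horizontal edges of a diagram -/

namespace BrauerDiagram

variable {m : ℕ}

/-- The number of bottom dots that are joined to bottom dots, that is, twice the number of
horizontal edges in the bottom row. -/
def bottomCount (d : BrauerDiagram m) : ℕ :=
  (Finset.univ.filter fun k : Fin m => (d.1 (Sum.inr k)).isRight).card

lemma card_top_isLeft (d : BrauerDiagram m) :
    (Finset.univ.filter fun k : Fin m => (d.1 (Sum.inl k)).isLeft).card = bottomCount d := by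
  have h1 := Finset.card_filter_add_card_filter_not (s := (Finset.univ : Finset (Fin m)))
    (fun k => (d.1 (Sum.inl k)).isLeft)
  have h2 := Finset.card_filter_add_card_filter_not (s := (Finset.univ : Finset (Fin m)))
    (fun k => (d.1 (Sum.inr k)).isRight)
  have h3 : (Finset.univ.filter fun k : Fin m => ¬ (d.1 (Sum.inl k)).isLeft).card =
      (Finset.univ.filter fun k : Fin m => ¬ (d.1 (Sum.inr k)).isRight).card := by
    refine Finset.card_bij' (fun k _ => (d.1 (Sum.inl k)).elim id id)
      (fun k _ => (d.1 (Sum.inr k)).elim id id) ?_ ?_ ?_ ?_ <;> intro k hk <;>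
      simp only [Finset.mem_filter, Finset.mem_univ, true_and, Bool.not_eq_true,
        Sum.isLeft_eq_false, Sum.isRight_eq_false] at hk ⊢ <;>
      simp only [Sum.isRight_iff, Sum.isLeft_iff] at hk <;>
      obtain ⟨j, hj⟩ := hk <;> simp [hj, ← d.apply_eq_iff.1 hj]
  unfold bottomCount
  omega

lemma card_top_isRight (d : BrauerDiagram m) :
    (Finset.univ.filter fun k : Fin m => (d.1 (Sum.inl k)).isRight).card + bottomCount d = m := by
  have h1 := Finset.card_filter_add_card_filter_not (s := (Finset.univ : Finset (Fin m)))
    (fun k => (d.1 (Sum.inl k)).isLeft)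
  have h2 := card_top_isLeft d
  simp only [Bool.not_eq_true, Sum.isLeft_eq_false, Finset.card_univ, Fintype.card_fin] at h1
  omega

lemma card_bottom_isLeft (d : BrauerDiagram m) :
    (Finset.univ.filter fun k : Fin m => (d.1 (Sum.inr k)).isLeft).card + bottomCount d = m := by
  have h1 := Finset.card_filter_add_card_filter_not (s := (Finset.univ : Finset (Fin m)))
    (fun k => (d.1 (Sum.inr k)).isLeft)
  simp only [Bool.not_eq_true, Sum.isLeft_eq_false, Finset.card_univ, Fintype.card_fin] at h1
  exact h1

lemma bottomCount_conj_bottom (d : BrauerDiagram m) (p q : Fin m) :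
    bottomCount (conj (Equiv.swap (Sum.inr p) (Sum.inr q)) d) = bottomCount d := by
  have e : ∀ k, Equiv.swap (Sum.inr p) (Sum.inr q) (Sum.inr k : BrauerDots m) =
      Sum.inr (Equiv.swap p q k) := by
    intro k
    simp only [Equiv.swap_apply_def, Sum.inr.injEq]
    split_ifs <;> rfl
  have e' : ∀ v : BrauerDots m, (Equiv.swap (Sum.inr p) (Sum.inr q) v).isRight = v.isRight := by
    rintro (k | k)
    · rw [Equiv.swap_apply_of_ne_of_ne (by simp) (by simp)]
    · rw [e]; rfl
  refine Finset.card_equiv (Equiv.swap p q) fun k => ?_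
  simp only [Finset.mem_filter, Finset.mem_univ, true_and, conj_swap_apply, e, e']

lemma conj_top_apply_right {d : BrauerDiagram m} {k a b : Fin m}
    (hab : d.1 (Sum.inr b) = Sum.inr a) :
    (conj (Equiv.swap (Sum.inl k) (Sum.inr b)) d).1 (Sum.inr b) = d.1 (Sum.inl k) := by
  rw [conj_swap_apply, Equiv.swap_apply_right,
    Equiv.swap_apply_of_ne_of_ne (d.2 _).1]
  intro e
  rw [d.apply_eq_iff, hab] at e
  simp at e

/-- Exchanging a top dot with the end of a horizontal bottom edge destroys this edge; a new
horizontal bottom edge arises if the top dot is joined to a bottom dot. -/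
lemma bottomCount_conj_top {d : BrauerDiagram m} {k a b : Fin m}
    (hab : d.1 (Sum.inr b) = Sum.inr a) :
    bottomCount (conj (Equiv.swap (Sum.inl k) (Sum.inr b)) d) +
      (if (d.1 (Sum.inl k)).isLeft then 2 else 0) = bottomCount d := by
  have hba : d.1 (Sum.inr a) = Sum.inr b := by rw [← hab, d.apply_apply]
  have hne : a ≠ b := by
    rintro rfl
    exact (d.2 _).1 hab
  have hx : ∀ x, x ≠ b → x ≠ a → d.1 (Sum.inl k) ≠ Sum.inr x →
      (conj (Equiv.swap (Sum.inl k) (Sum.inr b)) d).1 (Sum.inr x) = d.1 (Sum.inr x) := by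
    intro x h1 h2 h3
    rw [conj_swap_apply, Equiv.swap_apply_of_ne_of_ne (x := Sum.inr x) (by simp) (by simpa),
      Equiv.swap_apply_of_ne_of_ne]
    · exact fun e => h3 (d.apply_eq_iff.1 e).symm
    · intro e
      rw [d.apply_eq_iff, hab] at e
      exact h2 (by simpa using e)
  have hxa : (conj (Equiv.swap (Sum.inl k) (Sum.inr b)) d).1 (Sum.inr a) = Sum.inl k := by
    rw [conj_swap_apply, Equiv.swap_apply_of_ne_of_ne (x := Sum.inr a) (by simp) (by simpa), hba,
      Equiv.swap_apply_right]
  have hxb := conj_top_apply_right (k := k) hab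
  unfold bottomCount
  rcases hk : d.1 (Sum.inl k) with j | j
  · have e : (Finset.univ.filter fun x : Fin m =>
        ((conj (Equiv.swap (Sum.inl k) (Sum.inr b)) d).1 (Sum.inr x)).isRight) =
        ((Finset.univ.filter fun x : Fin m => (d.1 (Sum.inr x)).isRight).erase a).erase b := by
      ext x
      simp only [Finset.mem_filter, Finset.mem_univ, true_and, Finset.mem_erase]
      by_cases h1 : x = b
      · subst h1; simp [hxb, hk]
      by_cases h2 : x = a
      · subst h2; simp [hxa]
      rw [hx x h1 h2 (by simp [hk])]
      simp [h1, h2]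
    rw [e, Finset.card_erase_of_mem, Finset.card_erase_of_mem]
    · have : 1 < (Finset.univ.filter fun x : Fin m => (d.1 (Sum.inr x)).isRight).card :=
        Finset.one_lt_card.2 ⟨a, by simp [hba], b, by simp [hab], hne⟩
      simp only [Sum.isLeft_inl, if_true]
      omega
    · simp [hba]
    · simp [hab, hne.symm]
  · have hj : d.1 (Sum.inr j) = Sum.inl k := by rw [← hk, d.apply_apply]
    have hjb : j ≠ b := by rintro rfl; simp [hab] at hj
    have hja : j ≠ a := by rintro rfl; simp [hba] at hj
    have hxj : (conj (Equiv.swap (Sum.inl k) (Sum.inr b)) d).1 (Sum.inr j) = Sum.inr b := by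
      rw [conj_swap_apply, Equiv.swap_apply_of_ne_of_ne (x := Sum.inr j) (by simp) (by simpa), hj,
        Equiv.swap_apply_left]
    have e : (Finset.univ.filter fun x : Fin m =>
        ((conj (Equiv.swap (Sum.inl k) (Sum.inr b)) d).1 (Sum.inr x)).isRight) =
        insert j ((Finset.univ.filter fun x : Fin m => (d.1 (Sum.inr x)).isRight).erase a) := by
      ext x
      simp only [Finset.mem_filter, Finset.mem_univ, true_and, Finset.mem_erase,
        Finset.mem_insert]
      by_cases h1 : x = b
      · subst h1; simp [hxb, hk, hab, hne.symm]
      by_cases h2 : x = a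
      · subst h2; simp [hxa, hja.symm]
      by_cases h3 : x = j
      · subst h3; simp [hxj]
      rw [hx x h1 h2 (by rw [hk]; simpa using fun e => h3 e.symm)]
      simp [h2, h3]
    have hpos : 0 < (Finset.univ.filter fun x : Fin m => (d.1 (Sum.inr x)).isRight).card :=
      Finset.card_pos.2 ⟨a, by simp [hba]⟩
    rw [e, Finset.card_insert_of_notMem (by simp [hj]), Finset.card_erase_of_mem (by simp [hba])]
    simp only [Sum.isLeft_inr, Bool.false_eq_true, if_false]
    omega

lemma two_le_bottomCount {d : BrauerDiagram m} {a b : Fin m}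
    (hab : d.1 (Sum.inr b) = Sum.inr a) : 2 ≤ bottomCount d := by
  have hba : d.1 (Sum.inr a) = Sum.inr b := by rw [← hab, d.apply_apply]
  refine Finset.one_lt_card.2 ⟨a, by simp [hba], b, by simp [hab], ?_⟩
  rintro rfl
  exact (d.2 _).1 hab

lemma extend_map (d : BrauerDiagram m) (v : BrauerDots m) :
    d.extend.1 (Sum.map Fin.castSucc Fin.castSucc v) =
      Sum.map Fin.castSucc Fin.castSucc (d.1 v) := by
  cases v <;> simp [extend]

lemma extend_inl_last (d : BrauerDiagram m) :
    d.extend.1 (Sum.inl (Fin.last m)) = Sum.inr (Fin.last m) := by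
  simp [extend]

lemma extend_inr_last (d : BrauerDiagram m) :
    d.extend.1 (Sum.inr (Fin.last m)) = Sum.inl (Fin.last m) := by
  simp [extend]

lemma map_castSucc_injective : Function.Injective
    (Sum.map Fin.castSucc Fin.castSucc : BrauerDots m → BrauerDots (m + 1)) :=
  Sum.map_injective.2 ⟨Fin.castSucc_injective m, Fin.castSucc_injective m⟩

lemma extend_injective : Function.Injective (extend : BrauerDiagram m → _) := by
  intro d d' h
  ext v : 2
  apply map_castSucc_injective
  rw [← extend_map, ← extend_map, h]

lemma exists_extend_eq {d : BrauerDiagram (m + 1)}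
    (hd : d.1 (Sum.inl (Fin.last m)) = Sum.inr (Fin.last m)) :
    ∃ d' : BrauerDiagram m, d'.extend = d := by
  have hd' : d.1 (Sum.inr (Fin.last m)) = Sum.inl (Fin.last m) := by rw [← hd, d.apply_apply]
  have hrange : ∀ w : BrauerDots (m + 1), w ≠ Sum.inl (Fin.last m) → w ≠ Sum.inr (Fin.last m) →
      ∃ v : BrauerDots m, Sum.map Fin.castSucc Fin.castSucc v = w := by
    rintro (k | k) h1 h2
    · exact ⟨Sum.inl (k.castPred (by simpa using h1)), by simp⟩
    · exact ⟨Sum.inr (k.castPred (by simpa using h2)), by simp⟩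
  have hex : ∀ v : BrauerDots m, ∃ w : BrauerDots m,
      Sum.map Fin.castSucc Fin.castSucc w = d.1 (Sum.map Fin.castSucc Fin.castSucc v) := by
    intro v
    refine hrange _ (fun e => ?_) fun e => ?_
    · rw [d.apply_eq_iff, hd] at e
      rcases v with k | k <;> simp [Fin.castSucc_ne_last] at e
    · rw [d.apply_eq_iff, hd'] at e
      rcases v with k | k <;> simp [Fin.castSucc_ne_last] at e
  choose g hg using hex
  refine ⟨⟨g, fun v => ⟨fun e => ?_, ?_⟩⟩, ?_⟩
  · exact (d.2 (Sum.map Fin.castSucc Fin.castSucc v)).1 (by rw [← hg, e])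
  · apply map_castSucc_injective
    rw [hg, hg, d.apply_apply]
  · ext w : 2
    by_cases h1 : w = Sum.inl (Fin.last m)
    · rw [h1, extend_inl_last, hd]
    by_cases h2 : w = Sum.inr (Fin.last m)
    · rw [h2, extend_inr_last, hd']
    · obtain ⟨v, rfl⟩ := hrange w h1 h2
      rw [extend_map, ← hg]

lemma bottomCount_extend (d : BrauerDiagram m) : bottomCount d.extend = bottomCount d := by
  have h : ∀ k : Fin m, d.extend.1 (Sum.inr k.castSucc) =
      Sum.map Fin.castSucc Fin.castSucc (d.1 (Sum.inr k)) := fun k => extend_map d (Sum.inr k)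
  simp only [bottomCount, Finset.card_filter, Fin.sum_univ_castSucc, extend_inr_last, h,
    Sum.isRight_map, Sum.isRight_inl, Bool.false_eq_true, if_false, add_zero]

end BrauerDiagram

/-! ### The symmetrizer and the eigenvectors of the Jucys--Murphy element -/

namespace BrauerAlgebra

open BrauerDiagram

variable {K : Type} [Field K] {m : ℕ}

/-- The coefficient in the symmetrizer `S^{(m)}` of the diagrams with `b` horizontal bottom dots:
for `b = 2r` it is `(1/m!) (-1)^r` divided by the binomial coefficient of `ω/2 + m - 2` over `r`.
The value at odd `b`, which never occurs, is set to zero. -/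
def symmetrizerCoeff (ω : K) (m : ℕ) : ℕ → K
  | 0 => 1 / (m.factorial : K)
  | 1 => 0
  | b + 2 => -(b + 2) / (ω + 2 * m - 4 - b) * symmetrizerCoeff ω m b

/-- The explicit form of the symmetrizer. -/
def symmetrizer (ω : K) (m : ℕ) : BrauerAlgebra K ω m :=
  fun d => symmetrizerCoeff ω m (bottomCount d)

/-- The image of the symmetrizer in the next Brauer algebra: see `incl_symmetrizer`. -/
def symmetrizerIncl (ω : K) (m : ℕ) : BrauerAlgebra K ω (m + 1) := fun d =>
  if d.1 (Sum.inl (Fin.last m)) = Sum.inr (Fin.last m) then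
    symmetrizerCoeff ω m (bottomCount d) else 0

/-- The product of `symmetrizerIncl` with the sum of all `s_{aB} - ε_{aB}`, where `B` is the last
dot. -/
def symmetrizerStep (ω : K) (m : ℕ) : BrauerAlgebra K ω (m + 1) := fun d =>
  if (d.1 (Sum.inr (Fin.last m))).isLeft then
    if (d.1 (Sum.inl (Fin.last m))).isRight ∧ d.1 (Sum.inl (Fin.last m)) ≠ Sum.inr (Fin.last m)
    then symmetrizerCoeff ω m (bottomCount d) else 0
  else if (d.1 (Sum.inl (Fin.last m))).isLeft then
    -symmetrizerCoeff ω m (bottomCount d - 2) else 0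

lemma incl_symmetrizer (ω : K) (m : ℕ) :
    incl (symmetrizer ω m) = symmetrizerIncl ω m := by
  funext d
  simp only [incl, sum_apply, smul_apply, ofDiagram_apply, symmetrizerIncl, symmetrizer]
  split_ifs with h
  · obtain ⟨d', rfl⟩ := exists_extend_eq h
    rw [Finset.sum_eq_single d']
    · simp [bottomCount_extend]
    · intro d'' _ hne
      rw [if_neg fun e => hne (extend_injective e).symm, mul_zero]
    · simp
  · refine Finset.sum_eq_zero fun d' _ => ?_
    rw [if_neg, mul_zero]
    rintro rfl
    exact h (extend_inl_last d')

section Recurrence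

variable {ω : K}

lemma symmetrizerCoeff_add_two {b : ℕ} (h : ω + 2 * m - 4 - b ≠ 0) :
    (ω + 2 * m - 4 - b) * symmetrizerCoeff ω m (b + 2) = -(b + 2) * symmetrizerCoeff ω m b := by
  rw [symmetrizerCoeff]
  field_simp

lemma shift_ne_zero (hω : ∀ k : ℤ, ω + k ≠ 0) (m b : ℕ) : ω + 2 * m - 4 - b ≠ 0 := by
  have := hω (2 * m - 4 - b)
  push_cast at this
  rwa [show ω + 2 * (m : K) - 4 - b = ω + (2 * m - 4 - b) by ring]

lemma symmetrizerCoeff_succ [CharZero K] (hω : ∀ k : ℤ, ω + k ≠ 0) (m b : ℕ) :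
    (m + 1) * (ω + 2 * m - 2) * symmetrizerCoeff ω (m + 1) b =
      (ω + 2 * m - 2 - b) * symmetrizerCoeff ω m b := by
  induction b using Nat.twoStepInduction with
  | zero =>
    have : ((m.factorial : ℕ) : K) ≠ 0 := by exact_mod_cast m.factorial_ne_zero
    have h1 : (m : K) + 1 ≠ 0 := by exact_mod_cast m.succ_ne_zero
    simp only [symmetrizerCoeff, Nat.factorial_succ]
    push_cast
    field_simp
    simp
  | one => simp [symmetrizerCoeff]
  | more b ih _ =>
    have h1 := shift_ne_zero hω (m + 1) b
    have h2 := symmetrizerCoeff_add_two h1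
    have h3 := symmetrizerCoeff_add_two (shift_ne_zero hω m b)
    apply mul_left_cancel₀ h1
    push_cast at h1 h2 h3 ⊢
    linear_combination (m + 1 : K) * (ω + 2 * m - 2) * h2 - (b + 2 : K) * ih -
      (ω + 2 * (m + 1) - 4 - b) * h3

/-- The symmetrizer is an eigenvector of the Jucys--Murphy element, with the content of the last
box of the row as its eigenvalue. -/
lemma mulJucysMurphy_symmetrizer [CharZero K] (hω : ∀ k : ℤ, ω + k ≠ 0) {h : K}
    (hh : 2 * h = ω - 1) :
    mulJucysMurphy h (symmetrizer ω (m + 1)) = (h + m) • symmetrizer ω (m + 1) := by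
  funext d
  rw [smul_apply]
  rcases hB : d.1 (Sum.inr (Fin.last m)) with j | a
  · rw [mulJucysMurphy_of_isLeft _ _ (by simp [hB])]
    simp only [symmetrizer, bottomCount_conj_bottom, Finset.sum_const, Finset.card_univ,
      Fintype.card_fin, nsmul_eq_mul]
    ring
  · rw [mulJucysMurphy_of_isRight _ _ (by simp [hB])]
    obtain ⟨b, hb⟩ : ∃ b, bottomCount d = b + 2 := ⟨_, (Nat.sub_add_cancel
      (two_le_bottomCount hB)).symm⟩
    have hterm : ∀ k : Fin (m + 1), symmetrizer ω (m + 1)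
        (conj (Equiv.swap (Sum.inl k) (Sum.inr (Fin.last m))) d) =
        (if (d.1 (Sum.inl k)).isLeft then symmetrizerCoeff ω (m + 1) b else 0) +
          if (d.1 (Sum.inl k)).isRight then symmetrizerCoeff ω (m + 1) (b + 2) else 0 := by
      intro k
      have := bottomCount_conj_top (k := k) hB
      rcases hk : d.1 (Sum.inl k) with i | i <;> simp [hb, hk] at this <;>
        simp [symmetrizer, this]
    have hl := card_top_isLeft d
    have hr : ((Finset.univ.filter fun k : Fin (m + 1) => (d.1 (Sum.inl k)).isRight).card : K) +
        (b + 2) = m + 1 := by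
      have := card_top_isRight d
      rw [hb] at this
      exact_mod_cast this
    have hrec := symmetrizerCoeff_add_two (shift_ne_zero hω (m + 1) b)
    rw [Finset.sum_congr rfl fun k _ => hterm k, Finset.sum_add_distrib, ← Finset.sum_filter,
      ← Finset.sum_filter, Finset.sum_const, Finset.sum_const, hl, nsmul_eq_mul, nsmul_eq_mul,
      symmetrizer, hb]
    push_cast at hrec ⊢
    linear_combination -hrec - symmetrizerCoeff ω (m + 1) (b + 2) * hr -
      symmetrizerCoeff ω (m + 1) (b + 2) * hh

lemma mulJucysMurphy_symmetrizerIncl (ω h : K) :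
    mulJucysMurphy h (symmetrizerIncl ω m) = h • symmetrizerIncl ω m + symmetrizerStep ω m := by
  funext d
  rw [add_apply, smul_apply]
  rcases hB : d.1 (Sum.inr (Fin.last m)) with j | a
  · rw [mulJucysMurphy_of_isLeft _ _ (by simp [hB]), add_right_inj]
    have hterm : ∀ k : Fin m, symmetrizerIncl ω m
        (conj (Equiv.swap (Sum.inr k.castSucc) (Sum.inr (Fin.last m))) d) =
        if d.1 (Sum.inl (Fin.last m)) = Sum.inr k.castSucc then
          symmetrizerCoeff ω m (bottomCount d) else 0 := by
      intro k
      rw [symmetrizerIncl, bottomCount_conj_bottom, conj_swap_apply,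
        Equiv.swap_apply_of_ne_of_ne (x := Sum.inl _) (by simp) (by simp)]
      congr 1
      rw [Equiv.swap_apply_eq_iff, Equiv.swap_apply_right]
    rw [Finset.sum_congr rfl fun k _ => hterm k, symmetrizerStep, if_pos (by simp [hB])]
    rcases hT : d.1 (Sum.inl (Fin.last m)) with t | t
    · simp
    · rcases Fin.eq_castSucc_or_eq_last t with ⟨i, rfl⟩ | rfl
      · simp
      · simp [(Fin.castSucc_ne_last _).symm]
  · rw [mulJucysMurphy_of_isRight _ _ (by simp [hB])]
    have hTB : d.1 (Sum.inl (Fin.last m)) ≠ Sum.inr (Fin.last m) := by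
      intro e
      rw [d.apply_eq_iff, hB] at e
      simp at e
    have h0 : symmetrizerIncl ω m d = 0 := if_neg hTB
    have hterm : ∀ k : Fin (m + 1), symmetrizerIncl ω m
        (conj (Equiv.swap (Sum.inl k) (Sum.inr (Fin.last m))) d) =
        if d.1 (Sum.inl (Fin.last m)) = Sum.inl k then
          symmetrizerCoeff ω m (bottomCount d - 2) else 0 := by
      intro k
      have hb := bottomCount_conj_top (k := k) hB
      rw [symmetrizerIncl, conj_swap_apply]
      by_cases hk : k = Fin.last m
      · subst hk
        rw [Equiv.swap_apply_left, hB, if_neg (d.2 _).1, if_neg]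
        rw [Equiv.swap_apply_eq_iff, Equiv.swap_apply_right]
        simp
      · rw [Equiv.swap_apply_of_ne_of_ne (x := Sum.inl _) (by simpa using fun e => hk e.symm)
          (by simp)]
        simp only [Equiv.swap_apply_eq_iff, Equiv.swap_apply_right]
        refine if_ctx_congr Iff.rfl (fun e => ?_) fun _ => rfl
        rw [d.apply_eq_iff] at e
        rw [← e] at hb
        simp only [Sum.isLeft_inl, if_true] at hb
        rw [← hb, Nat.add_sub_cancel]
    rw [Finset.sum_congr rfl fun k _ => hterm k, symmetrizerStep, if_neg (by simp [hB]), h0]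
    rcases hT : d.1 (Sum.inl (Fin.last m)) with t | t <;> simp

lemma symmetrizerStep_of_isLeft {d : BrauerDiagram (m + 1)}
    (hB : (d.1 (Sum.inr (Fin.last m))).isLeft) : symmetrizerStep ω m d =
      if (d.1 (Sum.inl (Fin.last m))).isRight ∧
          d.1 (Sum.inl (Fin.last m)) ≠ Sum.inr (Fin.last m)
      then symmetrizerCoeff ω m (bottomCount d) else 0 := if_pos hB

lemma symmetrizerStep_of_isRight {d : BrauerDiagram (m + 1)}
    (hB : (d.1 (Sum.inr (Fin.last m))).isRight) : symmetrizerStep ω m d =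
      if (d.1 (Sum.inl (Fin.last m))).isLeft then
        -symmetrizerCoeff ω m (bottomCount d - 2) else 0 := if_neg (by simpa using hB)

/-- `A + G - (m+1) S`, with `A`, `G`, `S` for `symmetrizerIncl`, `symmetrizerStep` and the
symmetrizer of `B_{m+1}(ω)`, is an eigenvector of the Jucys--Murphy element: it belongs to the
tableau in which the last box of the row of length `m` is removed. This determines the image
of `G`. -/
lemma mulJucysMurphy_symmetrizerStep [CharZero K] (hω : ∀ k : ℤ, ω + k ≠ 0) {h : K}
    (hh : 2 * h = ω - 1) :
    mulJucysMurphy h (symmetrizerStep ω m) = -(ω + m - 2) • symmetrizerIncl ω m -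
      (h + m) • symmetrizerStep ω m +
        ((m + 1) * (ω + 2 * m - 2)) • symmetrizer ω (m + 1) := by
  funext d
  rw [add_apply, sub_apply, smul_apply, smul_apply, smul_apply, symmetrizer,
    symmetrizerCoeff_succ hω]
  rcases hB : d.1 (Sum.inr (Fin.last m)) with j | a
  · rw [mulJucysMurphy_of_isLeft _ _ (by simp [hB])]
    have hBT : ∀ k : Fin m,
        (conj (Equiv.swap (Sum.inr k.castSucc) (Sum.inr (Fin.last m))) d).1
          (Sum.inr (Fin.last m)) = d.1 (Sum.inr k.castSucc) := by
      intro k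
      rw [conj_swap_apply, Equiv.swap_apply_right, Equiv.swap_apply_of_ne_of_ne (d.2 _).1]
      intro e
      rw [d.apply_eq_iff, hB] at e
      simp at e
    have hTT : ∀ k : Fin m,
        (conj (Equiv.swap (Sum.inr k.castSucc) (Sum.inr (Fin.last m))) d).1
          (Sum.inl (Fin.last m)) = Equiv.swap (Sum.inr k.castSucc) (Sum.inr (Fin.last m))
            (d.1 (Sum.inl (Fin.last m))) := by
      intro k
      rw [conj_swap_apply, Equiv.swap_apply_of_ne_of_ne (x := Sum.inl _) (by simp) (by simp)]
    have hcard : ((Finset.univ.filter fun k : Fin m =>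
        (d.1 (Sum.inr k.castSucc)).isLeft).card : K) + bottomCount d = m := by
      have := card_bottom_isLeft d
      rw [Finset.card_filter, Fin.sum_univ_castSucc, if_pos (by simp [hB]), ← Finset.card_filter]
        at this
      exact_mod_cast (by omega : (Finset.univ.filter fun k : Fin m =>
        (d.1 (Sum.inr k.castSucc)).isLeft).card + bottomCount d = m)
    rcases hT : d.1 (Sum.inl (Fin.last m)) with t | t
    · -- the last top dot is joined to a top dot
      obtain ⟨b, hb⟩ : ∃ b, bottomCount d = b + 2 := by
        refine ⟨_, (Nat.sub_add_cancel ?_).symm⟩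
        rw [← card_top_isLeft]
        refine Finset.one_lt_card.2 ⟨Fin.last m, by simp [hT], t, ?_, ?_⟩
        · simp [← hT, d.apply_apply]
        · rintro rfl
          exact (d.2 _).1 hT
      have hterm : ∀ k : Fin m, symmetrizerStep ω m
          (conj (Equiv.swap (Sum.inr k.castSucc) (Sum.inr (Fin.last m))) d) =
          -symmetrizerCoeff ω m b + if (d.1 (Sum.inr k.castSucc)).isLeft then
            symmetrizerCoeff ω m b else 0 := by
        intro k
        have e := hTT k
        rw [hT, Equiv.swap_apply_of_ne_of_ne (x := Sum.inl _) (by simp) (by simp)] at e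
        rcases hk : d.1 (Sum.inr k.castSucc) with i | i
        · rw [symmetrizerStep_of_isLeft (by rw [hBT, hk]; rfl), e]
          simp
        · rw [symmetrizerStep_of_isRight (by rw [hBT, hk]; rfl), e, bottomCount_conj_bottom, hb]
          simp
      have hrec := symmetrizerCoeff_add_two (shift_ne_zero hω m b)
      rw [Finset.sum_congr rfl fun k _ => hterm k, Finset.sum_add_distrib, ← Finset.sum_filter,
        Finset.sum_const, Finset.sum_const, Finset.card_univ, Fintype.card_fin, nsmul_eq_mul,
        nsmul_eq_mul, symmetrizerStep_of_isLeft (by rw [hB]; rfl), hT, symmetrizerIncl, hT, hb]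
      rw [hb] at hcard
      simp only [Sum.isRight_inl, reduceCtorEq, if_false, Bool.false_eq_true, false_and]
      push_cast at hcard ⊢
      linear_combination symmetrizerCoeff ω m b * hcard - hrec
    · rcases Fin.eq_castSucc_or_eq_last t with ⟨i, rfl⟩ | rfl
      · -- both last dots are joined to dots of the other row
        have hi : d.1 (Sum.inr i.castSucc) = Sum.inl (Fin.last m) := by
          rw [← hT, d.apply_apply]
        have hterm : ∀ k : Fin m, symmetrizerStep ω m
            (conj (Equiv.swap (Sum.inr k.castSucc) (Sum.inr (Fin.last m))) d) =
            (if (d.1 (Sum.inr k.castSucc)).isLeft then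
              symmetrizerCoeff ω m (bottomCount d) else 0) -
            if k = i then symmetrizerCoeff ω m (bottomCount d) else 0 := by
          intro k
          have e := hTT k
          rw [hT] at e
          by_cases hki : k = i
          · subst hki
            rw [Equiv.swap_apply_left] at e
            rw [symmetrizerStep_of_isLeft (by rw [hBT, hi]; rfl), e, hi]
            simp
          · rw [Equiv.swap_apply_of_ne_of_ne (x := Sum.inr _)
              (by simpa using fun e => hki e.symm) (by simp)] at e
            rcases hk : d.1 (Sum.inr k.castSucc) with i | i
            · rw [symmetrizerStep_of_isLeft (by rw [hBT, hk]; rfl), e, bottomCount_conj_bottom]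
              simp [hki]
            · rw [symmetrizerStep_of_isRight (by rw [hBT, hk]; rfl), e]
              simp [hki]
        rw [Finset.sum_congr rfl fun k _ => hterm k, Finset.sum_sub_distrib, ← Finset.sum_filter,
          Finset.sum_const, nsmul_eq_mul, Finset.sum_ite_eq', if_pos (Finset.mem_univ _),
          symmetrizerStep_of_isLeft (by rw [hB]; rfl), hT, symmetrizerIncl, hT]
        rw [if_pos ⟨rfl, by simp⟩, if_neg (by simp)]
        linear_combination symmetrizerCoeff ω m (bottomCount d) * (hcard + hh)
      · -- the last dots are joined to each other
        have hterm : ∀ k : Fin m, symmetrizerStep ω m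
            (conj (Equiv.swap (Sum.inr k.castSucc) (Sum.inr (Fin.last m))) d) =
            if (d.1 (Sum.inr k.castSucc)).isLeft then
              symmetrizerCoeff ω m (bottomCount d) else 0 := by
          intro k
          have e := hTT k
          rw [hT, Equiv.swap_apply_right] at e
          rcases hk : d.1 (Sum.inr k.castSucc) with i | i
          · rw [symmetrizerStep_of_isLeft (by rw [hBT, hk]; rfl), e, bottomCount_conj_bottom]
            simp
          · rw [symmetrizerStep_of_isRight (by rw [hBT, hk]; rfl), e]
            simp
        rw [Finset.sum_congr rfl fun k _ => hterm k, ← Finset.sum_filter,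
          Finset.sum_const, nsmul_eq_mul, symmetrizerStep_of_isLeft (by rw [hB]; rfl), hT,
          symmetrizerIncl, hT]
        simp only [ne_eq, not_true_eq_false, and_false, if_false, if_true]
        linear_combination symmetrizerCoeff ω m (bottomCount d) * hcard
  · rw [mulJucysMurphy_of_isRight _ _ (by simp [hB])]
    obtain ⟨b, hb⟩ : ∃ b, bottomCount d = b + 2 := ⟨_, (Nat.sub_add_cancel
      (two_le_bottomCount hB)).symm⟩
    have hTB : d.1 (Sum.inl (Fin.last m)) ≠ Sum.inr (Fin.last m) := by
      intro e
      rw [d.apply_eq_iff, hB] at e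
      simp at e
    have hBT := fun k => conj_top_apply_right (k := k) hB
    have hTT : ∀ k, k ≠ Fin.last m →
        (conj (Equiv.swap (Sum.inl k) (Sum.inr (Fin.last m))) d).1 (Sum.inl (Fin.last m)) =
          if d.1 (Sum.inl (Fin.last m)) = Sum.inl k then Sum.inr (Fin.last m) else
            d.1 (Sum.inl (Fin.last m)) := by
      intro k hk
      rw [conj_swap_apply, Equiv.swap_apply_of_ne_of_ne (x := Sum.inl _)
        (by simpa using fun e => hk e.symm) (by simp), Equiv.swap_apply_def, if_neg hTB]
    have hTlast : (conj (Equiv.swap (Sum.inl (Fin.last m)) (Sum.inr (Fin.last m))) d).1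
        (Sum.inl (Fin.last m)) = Sum.inr a := by
      rw [conj_swap_apply, Equiv.swap_apply_left, hB, Equiv.swap_apply_of_ne_of_ne (by simp)]
      rw [← hB]
      exact (d.2 _).1
    have ha : a ≠ Fin.last m := by
      rintro rfl
      exact (d.2 _).1 hB
    have hl := card_top_isLeft d
    have hr : ((Finset.univ.filter fun k : Fin (m + 1) => (d.1 (Sum.inl k)).isRight).card : K) +
        (b + 2) = m + 1 := by
      have := card_top_isRight d
      rw [hb] at this
      exact_mod_cast this
    have hcount : ∀ k, (d.1 (Sum.inl k)).isLeft →
        bottomCount (conj (Equiv.swap (Sum.inl k) (Sum.inr (Fin.last m))) d) = b := by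
      intro k hk
      have := bottomCount_conj_top (k := k) hB
      rw [if_pos hk, hb] at this
      omega
    have hcount' : ∀ k, (d.1 (Sum.inl k)).isRight →
        bottomCount (conj (Equiv.swap (Sum.inl k) (Sum.inr (Fin.last m))) d) = b + 2 := by
      intro k hk
      have := bottomCount_conj_top (k := k) hB
      rw [if_neg (by simpa using hk), hb] at this
      omega
    have hrec := symmetrizerCoeff_add_two (shift_ne_zero hω m b)
    rcases hT : d.1 (Sum.inl (Fin.last m)) with t | t
    · -- both last dots are joined to dots of the same row
      have hterm : ∀ k : Fin (m + 1), symmetrizerStep ω m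
          (conj (Equiv.swap (Sum.inl k) (Sum.inr (Fin.last m))) d) =
          (if k = Fin.last m then symmetrizerCoeff ω m b else 0) -
            if (d.1 (Sum.inl k)).isRight then symmetrizerCoeff ω m b else 0 := by
        intro k
        by_cases hk : k = Fin.last m
        · subst hk
          rw [symmetrizerStep_of_isLeft (by rw [hBT, hT]; rfl), hTlast, hcount _ (by rw [hT]; rfl),
            if_pos ⟨rfl, by simpa using ha⟩, hT]
          simp
        · have e := hTT k hk
          rw [hT] at e
          rcases hkk : d.1 (Sum.inl k) with i | i
          · rw [symmetrizerStep_of_isLeft (by rw [hBT, hkk]; rfl), e, if_neg]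
            · simp [hk]
            · split_ifs <;> simp
          · have htk : (Sum.inl t : BrauerDots (m + 1)) ≠ Sum.inl k := by
              rw [← hT]
              intro e
              rw [d.apply_eq_iff, hkk] at e
              simp at e
            rw [symmetrizerStep_of_isRight (by rw [hBT, hkk]; rfl), e, if_neg htk, hcount' k
              (by rw [hkk]; rfl)]
            simp [hk]
      rw [Finset.sum_congr rfl fun k _ => hterm k, Finset.sum_sub_distrib, ← Finset.sum_filter,
        ← Finset.sum_filter, Finset.sum_const, Finset.sum_const, nsmul_eq_mul, nsmul_eq_mul,
        symmetrizerStep_of_isRight (by rw [hB]; rfl), hT, symmetrizerIncl, hT, hb,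
        Finset.filter_eq', if_pos (Finset.mem_univ _), Finset.card_singleton]
      simp only [Sum.isLeft_inl, reduceCtorEq, if_true, if_false, Nat.add_sub_cancel]
      push_cast
      linear_combination symmetrizerCoeff ω m b * hr - hrec
    · -- the last top dot is joined to a bottom dot
      have htB : (Sum.inr t : BrauerDots (m + 1)) ≠ Sum.inr (Fin.last m) := by rwa [← hT]
      have hterm : ∀ k : Fin (m + 1), symmetrizerStep ω m
          (conj (Equiv.swap (Sum.inl k) (Sum.inr (Fin.last m))) d) =
          if (d.1 (Sum.inl k)).isLeft then symmetrizerCoeff ω m b else 0 := by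
        intro k
        by_cases hk : k = Fin.last m
        · subst hk
          rw [symmetrizerStep_of_isRight (by rw [hBT, hT]; rfl), hTlast, hT]
          simp
        · have e := hTT k hk
          rw [hT, if_neg (by simp)] at e
          rcases hkk : d.1 (Sum.inl k) with i | i
          · rw [symmetrizerStep_of_isLeft (by rw [hBT, hkk]; rfl), e, hcount k (by rw [hkk]; rfl),
              if_pos ⟨rfl, htB⟩]
            simp
          · rw [symmetrizerStep_of_isRight (by rw [hBT, hkk]; rfl), e]
            simp
      rw [Finset.sum_congr rfl fun k _ => hterm k, ← Finset.sum_filter, Finset.sum_const, hl,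
        nsmul_eq_mul, symmetrizerStep_of_isRight (by rw [hB]; rfl), hT, symmetrizerIncl, hT, hb,
        if_neg htB]
      simp only [Sum.isLeft_inr, Bool.false_eq_true, if_false]
      push_cast
      linear_combination -hrec

end Recurrence

end BrauerAlgebra

/-! ### The recurrence for the symmetrizer and its uniqueness -/

namespace BrauerAlgebra

open BrauerDiagram

variable {K : Type} [Field K] {m : ℕ} {ω : K}

lemma const_apply (f : BrauerAlgebra K ω m) (d : BrauerDiagram m) : const f d = C (f d) := rfl

lemma const_ofDiagram (d : BrauerDiagram m) :
    const (ofDiagram d : BrauerAlgebra K ω m) = ofDiagram d := by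
  funext d'
  rw [const_apply, ofDiagram_apply, ofDiagram_apply]
  split_ifs <;> simp

lemma const_jucysMurphy (b : Fin m) :
    const (jucysMurphy ω b) = C ((ω - 1) / 2) • (1 : BrauerAlgebra K[X] (C ω) m) +
      ∑ a : {a : Fin m // a < b}, (ofDiagram (transposition a.1 b) -
        ofDiagram (contraction a.1 b a.2.ne)) := by
  have h1 : const (1 : BrauerAlgebra K ω m) = 1 := const_ofDiagram _
  funext d
  simp only [const_apply, jucysMurphy, add_apply, smul_apply, sum_apply, sub_apply, C_add, C_mul,
    map_sum, C_sub, ← h1, ← const_ofDiagram (ω := ω)]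

/-- Right multiplication by `u - x`, where `x` is the last Jucys--Murphy element. -/
lemma mul_X_sub_const_jucysMurphy [CharZero K] (P : BrauerAlgebra K[X] (C ω) (m + 1)) :
    P * ((X : K[X]) • (1 : BrauerAlgebra K[X] (C ω) (m + 1)) -
      const (jucysMurphy ω (Fin.last m))) =
      (X : K[X]) • P - mulJucysMurphy (C ((ω - 1) / 2)) P := by
  have hh : 2 * C ((ω - 1) / 2) = (C ω - 1 : K[X]) := by
    rw [← C_1, ← C_sub, ← C_ofNat, ← C_mul]
    congr 1
    field_simp
  rw [const_jucysMurphy, ← mul_eq_mulJucysMurphy hh, ← mulLeftLinear_apply, map_sub, map_smul,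
    mulLeftLinear_apply, mulLeftLinear_apply, mul_one]

lemma mulJucysMurphy_const (h : K) (f : BrauerAlgebra K ω (m + 1)) :
    mulJucysMurphy (C h) (const f) = const (mulJucysMurphy h f) := by
  funext d
  rw [const_apply]
  rcases hB : d.1 (Sum.inr (Fin.last m)) with j | a
  · rw [mulJucysMurphy_of_isLeft _ _ (by rw [hB]; rfl), mulJucysMurphy_of_isLeft _ _
      (by rw [hB]; rfl)]
    simp only [const_apply, C_add, C_mul, map_sum]
  · rw [mulJucysMurphy_of_isRight _ _ (by rw [hB]; rfl), mulJucysMurphy_of_isRight _ _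
      (by rw [hB]; rfl)]
    simp only [const_apply, C_sub, C_mul, C_neg, map_sum]

/-- `u - x` is not a right zero divisor: compare the degrees in `u`. -/
lemma eq_zero_of_X_smul_eq {h : K} {P : BrauerAlgebra K[X] (C ω) (m + 1)}
    (hP : (X : K[X]) • P = mulJucysMurphy (C h) P) : P = 0 := by
  by_contra hne
  obtain ⟨d₀, -, hmax⟩ := Finset.exists_max_image Finset.univ
    (fun d : BrauerDiagram (m + 1) => degree (P d))
    ⟨identity (m + 1), Finset.mem_univ _⟩
  have hle : ∀ d, degree (P d) ≤ degree (P d₀) := fun d => hmax d (Finset.mem_univ _)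
  have h0 : P d₀ ≠ 0 := by
    intro h0
    refine hne (funext fun d => ?_)
    have := hle d
    rw [h0, degree_zero, le_bot_iff, degree_eq_bot] at this
    exact this
  have hC : degree (C h * P d₀) ≤ degree (P d₀) := by
    rw [← smul_eq_C_mul]
    exact degree_smul_le h _
  have hsum : ∀ {n : ℕ} (F : Fin n → BrauerDiagram (m + 1)),
      degree (∑ k, P (F k)) ≤ degree (P d₀) := fun F =>
    (degree_sum_le _ _).trans (Finset.sup_le fun _ _ => hle _)
  have hX : degree (mulJucysMurphy (C h) P d₀) ≤ degree (P d₀) := by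
    rcases hB : d₀.1 (Sum.inr (Fin.last m)) with j | a
    · rw [mulJucysMurphy_of_isLeft _ _ (by rw [hB]; rfl)]
      exact (degree_add_le _ _).trans (max_le hC (hsum _))
    · rw [mulJucysMurphy_of_isRight _ _ (by rw [hB]; rfl)]
      refine (degree_sub_le _ _).trans (max_le ?_ (hsum _))
      rwa [neg_mul, degree_neg]
  rw [← hP, smul_apply, degree_mul, degree_X, degree_eq_natDegree h0] at hX
  norm_cast at hX
  omega

lemma IsValueOfFraction.unique [CharZero K] {A E E' : BrauerAlgebra K ω (m + 1)} {c : K}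
    (hE : IsValueOfFraction A (jucysMurphy ω (Fin.last m)) c E)
    (hE' : IsValueOfFraction A (jucysMurphy ω (Fin.last m)) c E') : E = E' := by
  obtain ⟨q, P, hq, hP, rfl⟩ := hE
  obtain ⟨q', P', hq', hP', rfl⟩ := hE'
  rw [mul_X_sub_const_jucysMurphy] at hP hP'
  have key : q' • P - q • P' = 0 := by
    refine eq_zero_of_X_smul_eq (h := (ω - 1) / 2) ?_
    rw [← sub_eq_zero, map_sub, map_smul, map_smul]
    calc _ = q' • ((X : K[X]) • P - mulJucysMurphy (C ((ω - 1) / 2)) P) -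
          q • ((X : K[X]) • P' - mulJucysMurphy (C ((ω - 1) / 2)) P') := by module
      _ = 0 := by rw [hP, hP']; module
  funext d
  have hd : q' * P d - q * P' d = 0 := congrFun key d
  have := congrArg (Polynomial.eval c) hd
  simp only [eval_sub, eval_mul, eval_zero] at this
  simp only [smul_apply, evalAt]
  field_simp
  linear_combination this

lemma IsPrimitiveIdempotent.unique [CharZero K] {T : ℕ → ℕ × ℕ} :
    ∀ {m : ℕ} {E E' : BrauerAlgebra K ω m}, IsPrimitiveIdempotent ω T m E →
      IsPrimitiveIdempotent ω T m E' → E = E'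
  | 0, _, _, h, h' => h.trans h'.symm
  | m + 1, _, _, ⟨F, hF, h⟩, ⟨F', hF', h'⟩ => by
    obtain rfl := hF.unique hF'
    exact h.unique h'

/-- With `A` the symmetrizer of `B_m(ω)`, `S` that of `B_{m+1}(ω)` and `x` the last Jucys--Murphy
element, `A` is the sum of eigenvectors of `x` with the eigenvalues `h + m`, `h - 1` and
`-(h + m - 1)`, the first of which is `S`. -/
lemma isValueOfFraction_symmetrizer [CharZero K] (hω : ∀ k : ℤ, ω + k ≠ 0) :
    IsValueOfFraction (symmetrizerIncl ω m) (jucysMurphy ω (Fin.last m)) ((ω - 1) / 2 + m)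
      (symmetrizer ω (m + 1)) := by
  obtain ⟨h, hh⟩ : ∃ h, h = (ω - 1) / 2 := ⟨_, rfl⟩
  have h2 : 2 * h = ω - 1 := by rw [hh]; field_simp
  have hS := mulJucysMurphy_symmetrizer (m := m) hω h2
  have hA := mulJucysMurphy_symmetrizerIncl (m := m) ω h
  have hG := mulJucysMurphy_symmetrizerStep (m := m) hω h2
  set S := symmetrizer ω (m + 1)
  set A := symmetrizerIncl ω m
  set G := symmetrizerStep ω m
  -- `D` is the sum of the last two eigenvectors, and `V` is a multiple of the last one
  set D := A - S with hD
  set V := A + G - ((m : K) + 1) • S with hV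
  have hxD : mulJucysMurphy h D = (h - 1) • D + V := by
    rw [hD, hV, map_sub, hA, hS]
    module
  have hxV : mulJucysMurphy h V = -(h + m - 1) • V := by
    rw [hV, map_sub, map_add, map_smul, hA, hS, hG]
    funext d
    simp only [add_apply, sub_apply, smul_apply]
    linear_combination (A d - (m + 1) * S d) * h2
  have hc : (h + m - (h - 1)) * (h + m + (h + m - 1)) ≠ 0 := by
    have e1 : h + m - (h - 1) = ((m + 1 : ℕ) : K) := by push_cast; ring
    have e2 : h + m + (h + m - 1) = ω + ((2 * m - 2 : ℤ) : K) := by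
      push_cast
      linear_combination h2
    rw [e1, e2]
    exact mul_ne_zero (by exact_mod_cast m.succ_ne_zero) (hω _)
  rw [← hh]
  refine ⟨(X - C (h - 1)) * (X + C (h + m - 1)),
    ((X - C (h - 1)) * (X + C (h + m - 1))) • const S +
      (X - C (h + m)) • ((X + C (h + m - 1)) • const D + const V), ?_, ?_, ?_⟩
  · simpa [add_sub_assoc] using hc
  · rw [mul_X_sub_const_jucysMurphy, ← hh]
    simp only [map_add, map_smul, mulJucysMurphy_const, hS, hxD, hxV]
    funext d
    simp only [sub_apply, add_apply, smul_apply, const_apply, hD, C_add, C_mul, C_sub, C_neg]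
    ring
  · funext d
    simp only [smul_apply, evalAt, add_apply, const_apply, eval_add, eval_mul, eval_sub, eval_X,
      eval_C, sub_self, zero_mul, add_zero]
    rw [← mul_assoc, inv_mul_cancel₀, one_mul]
    exact hc

theorem isPrimitiveIdempotent_symmetrizer [CharZero K] (hω : ∀ k : ℤ, ω + k ≠ 0) (m : ℕ) :
    IsPrimitiveIdempotent ω (fun r => (0, r)) m (symmetrizer ω m) := by
  induction m with
  | zero =>
    change symmetrizer ω 0 = ofDiagram (identity 0)
    funext d
    have hd : d = identity 0 := by
      ext v : 2
      rcases v with k | k <;> exact k.elim0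
    have hb : bottomCount d = 0 := by
      have := card_top_isRight d
      omega
    rw [ofDiagram_apply, if_pos hd, symmetrizer, hb]
    simp [symmetrizerCoeff]
  | succ m ih =>
    refine ⟨_, ih, ?_⟩
    rw [incl_symmetrizer]
    simpa using isValueOfFraction_symmetrizer hω

end BrauerAlgebra

/-! ### Wick's theorem -/

namespace Wick

open MvPolynomial

variable {ι R : Type*} [CommRing R]

/-- Derivations with constant values on the variables commute. -/
lemma derivation_comm {D D' : Derivation R (MvPolynomial ι R) (MvPolynomial ι R)}
    (h : ∀ i, ∃ r, D (X i) = MvPolynomial.C r) (h' : ∀ i, ∃ r, D' (X i) = MvPolynomial.C r)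
    (f : MvPolynomial ι R) :
    D (D' f) = D' (D f) := by
  have key : ⁅D, D'⁆ = 0 := by
    refine derivation_ext fun i => ?_
    obtain ⟨r, hr⟩ := h i
    obtain ⟨r', hr'⟩ := h' i
    rw [Derivation.commutator_apply, hr, hr', MvPolynomial.derivation_C, MvPolynomial.derivation_C]
    simp
  have := congrArg (fun E => E f) key
  simp only [Derivation.commutator_apply, Derivation.coe_zero, Pi.zero_apply] at this
  exact sub_eq_zero.1 this

lemma exists_pderiv_X (i j : ι) :
    ∃ r : R, pderiv i (X j : MvPolynomial ι R) = MvPolynomial.C r := by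
  by_cases h : j = i
  · exact ⟨1, by rw [h, pderiv_X_self, MvPolynomial.C_1]⟩
  · exact ⟨0, by rw [pderiv_X_of_ne h, MvPolynomial.C_0]⟩

lemma derivation_prod {V : Type*} [DecidableEq V]
    (D : Derivation R (MvPolynomial ι R) (MvPolynomial ι R)) (s : Finset V)
    (f : V → MvPolynomial ι R) :
    D (∏ v ∈ s, f v) = ∑ q ∈ s, (∏ v ∈ s.erase q, f v) * D (f q) := by
  induction s using Finset.induction_on with
  | empty => simp
  | insert a s ha ih =>
    rw [Finset.prod_insert ha, Derivation.leibniz, ih, Finset.sum_insert ha,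
      Finset.erase_insert ha, smul_eq_mul, smul_eq_mul, add_comm, Finset.mul_sum]
    congr 1
    refine Finset.sum_congr rfl fun q hq => ?_
    have hqa : a ≠ q := fun e => ha (e ▸ hq)
    rw [Finset.erase_insert_of_ne hqa, Finset.prod_insert fun h => ha (Finset.mem_of_mem_erase h),
      mul_assoc]

variable [Fintype ι]

/-- The derivation of `R[X_i]` that contracts the variable `a`: it sends `X_j` to the covariance
`w a j`. -/
def contract (w : ι → ι → R) (a : ι) : Derivation R (MvPolynomial ι R) (MvPolynomial ι R) :=
  ∑ j, w a j • pderiv j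

lemma contract_apply (w : ι → ι → R) (a : ι) (f : MvPolynomial ι R) :
    contract w a f = ∑ j, w a j • pderiv j f := by
  have h := congrFun (map_sum Derivation.coeFnAddMonoidHom (fun j => w a j • pderiv (R := R) j)
    Finset.univ) f
  rw [Finset.sum_apply] at h
  exact h

lemma contract_X (w : ι → ι → R) (a j : ι) :
    contract w a (X j : MvPolynomial ι R) = MvPolynomial.C (w a j) := by
  rw [contract_apply, Finset.sum_eq_single j]
  · rw [pderiv_X_self, MvPolynomial.smul_eq_C_mul, mul_one]
  · intro k _ hk
    rw [pderiv_X_of_ne hk.symm, smul_zero]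
  · simp

/-- The Laplace operator of the symmetric matrix `w` of covariances. -/
def laplacian (w : ι → ι → R) : MvPolynomial ι R →ₗ[R] MvPolynomial ι R :=
  ∑ i, (pderiv i).toLinearMap ∘ₗ (contract w i).toLinearMap

lemma laplacian_apply (w : ι → ι → R) (f : MvPolynomial ι R) :
    laplacian w f = ∑ i, pderiv i (contract w i f) := by
  simp [laplacian]

lemma contract_laplacian (w : ι → ι → R) (a : ι) (f : MvPolynomial ι R) :
    contract w a (laplacian w f) = laplacian w (contract w a f) := by
  have hw : ∀ i j, ∃ r, contract w i (X j : MvPolynomial ι R) = MvPolynomial.C r :=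
    fun i j => ⟨_, contract_X w i j⟩
  rw [laplacian_apply, laplacian_apply, map_sum]
  refine Finset.sum_congr rfl fun i _ => ?_
  rw [derivation_comm (hw a) (exists_pderiv_X i), derivation_comm (hw a) (hw i)]

lemma laplacian_X_mul {w : ι → ι → R} (hw : ∀ i j, w i j = w j i) (a : ι)
    (f : MvPolynomial ι R) :
    laplacian w (X a * f) = X a * laplacian w f + 2 * contract w a f := by
  have h1 : ∀ i, pderiv i (contract w i (X a * f)) = X a * pderiv i (contract w i f) +
      (pderiv i (X a) * contract w i f + w a i • pderiv i f) := by
    intro i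
    rw [Derivation.leibniz, contract_X, map_add, smul_eq_mul, smul_eq_mul, Derivation.leibniz,
      Derivation.leibniz, MvPolynomial.derivation_C, smul_eq_mul, smul_eq_mul, smul_eq_mul,
      smul_eq_mul, MvPolynomial.smul_eq_C_mul, hw i a]
    ring
  rw [laplacian_apply, laplacian_apply, Finset.sum_congr rfl fun i _ => h1 i,
    Finset.sum_add_distrib, Finset.sum_add_distrib, ← contract_apply, Finset.mul_sum,
    Finset.sum_eq_single (s := Finset.univ) (f := fun i => pderiv i (X a) * contract w i f) a,
    pderiv_X_self]
  · ring
  · intro i _ hi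
    rw [pderiv_X_of_ne hi.symm, zero_mul]
  · simp

lemma laplacian_pow_X_mul {w : ι → ι → R} (hw : ∀ i j, w i j = w j i) (a : ι) (k : ℕ)
    (f : MvPolynomial ι R) :
    (laplacian w ^ (k + 1)) (X a * f) = X a * (laplacian w ^ (k + 1)) f +
      (2 * (k + 1) : R) • (laplacian w ^ k) (contract w a f) := by
  induction k with
  | zero =>
    rw [zero_add, pow_one, pow_zero, laplacian_X_mul hw, Module.End.one_apply,
      MvPolynomial.smul_eq_C_mul]
    simp [map_ofNat]
  | succ k ih =>
    have h1 : contract w a ((laplacian w ^ (k + 1)) f) =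
        (laplacian w ^ (k + 1)) (contract w a f) := by
      generalize k + 1 = n
      induction n with
      | zero => rfl
      | succ n ihn =>
        rw [pow_succ', Module.End.mul_apply, Module.End.mul_apply, contract_laplacian, ihn]
    rw [pow_succ', Module.End.mul_apply, ih, map_add, map_smul, laplacian_X_mul hw, h1,
      Module.End.mul_apply, ← Module.End.mul_apply (laplacian w) (laplacian w ^ k), ← pow_succ',
      MvPolynomial.smul_eq_C_mul, MvPolynomial.smul_eq_C_mul]
    simp only [map_mul, map_add, map_ofNat, map_natCast, Nat.cast_add, Nat.cast_one, map_one]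
    ring

variable [Algebra ℚ R]

/-- The expectation of polynomials of degree `2k` in centered Gaussian variables with covariances
`w`; a polynomial is integrated by applying the `k`-th term of the exponential of half of the
Laplace operator. -/
def expect (w : ι → ι → R) (k : ℕ) : MvPolynomial ι R →ₗ[R] R where
  toFun f := (1 / (2 ^ k * k.factorial) : ℚ) • constantCoeff ((laplacian w ^ k) f)
  map_add' f g := by rw [map_add, map_add, smul_add]
  map_smul' r f := by
    rw [map_smul, MvPolynomial.smul_eq_C_mul, map_mul, constantCoeff_C, RingHom.id_apply,
      smul_eq_mul, mul_smul_comm]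

lemma expect_apply (w : ι → ι → R) (k : ℕ) (f : MvPolynomial ι R) : expect w k f =
    (1 / (2 ^ k * k.factorial) : ℚ) • constantCoeff ((laplacian w ^ k) f) := rfl

lemma mul_expect (w : ι → ι → R) (k : ℕ) (r : R) (f : MvPolynomial ι R) :
    r * expect w k f = expect w k (MvPolynomial.C r * f) := by
  rw [← MvPolynomial.smul_eq_C_mul, map_smul, smul_eq_mul]

lemma expect_one (w : ι → ι → R) : expect w 0 1 = 1 := by
  simp [expect_apply]

/-- Wick's rule: the first factor is contracted with each of the other factors. -/
lemma expect_X_mul {w : ι → ι → R} (hw : ∀ i j, w i j = w j i) (a : ι) (k : ℕ)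
    (f : MvPolynomial ι R) : expect w (k + 1) (X a * f) = expect w k (contract w a f) := by
  rw [expect_apply, expect_apply, laplacian_pow_X_mul hw, map_add, map_mul, constantCoeff_X,
    zero_mul, zero_add, MvPolynomial.smul_eq_C_mul, map_mul, constantCoeff_C]
  have h2 : (2 * (k + 1) : R) = algebraMap ℚ R (2 * (k + 1)) := by
    simp only [map_mul, map_add, map_ofNat, map_natCast, map_one]
  rw [h2, ← Algebra.smul_def, smul_smul]
  congr 1
  rw [Nat.factorial_succ]
  have := k.factorial_ne_zero
  push_cast
  field_simp
  ring

end Wick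

section PerfectMatchings

variable {V : Type*} [Fintype V] [DecidableEq V]

/-- The perfect matchings of a finite set `A`, as involutions whose set of moved points is `A`. -/
def perfectMatchings (A : Finset V) : Finset (Equiv.Perm V) :=
  Finset.univ.filter fun d => (∀ v, d (d v) = v) ∧ ∀ v, d v ≠ v ↔ v ∈ A

lemma mem_perfectMatchings {A : Finset V} {d : Equiv.Perm V} : d ∈ perfectMatchings A ↔
    (∀ v, d (d v) = v) ∧ ∀ v, d v ≠ v ↔ v ∈ A := by
  simp [perfectMatchings]

lemma perfectMatchings_empty : perfectMatchings (∅ : Finset V) = {1} := by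
  ext d
  simp only [mem_perfectMatchings, Finset.notMem_empty, iff_false, not_not, Finset.mem_singleton]
  exact ⟨fun h => Equiv.ext h.2, by rintro rfl; simp⟩

lemma mul_swap_mem_perfectMatchings {A : Finset V} {d : Equiv.Perm V}
    (hd : d ∈ perfectMatchings A) {a : V} (ha : a ∈ A) :
    d * Equiv.swap a (d a) ∈ perfectMatchings ((A.erase a).erase (d a)) := by
  obtain ⟨h1, h2⟩ := mem_perfectMatchings.1 hd
  have hval : ∀ v, (d * Equiv.swap a (d a)) v = if v = a ∨ v = d a then v else d v := by
    intro v
    rw [Equiv.Perm.mul_apply]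
    by_cases e1 : v = a
    · subst e1; simp [h1]
    by_cases e2 : v = d a
    · subst e2; simp
    · rw [Equiv.swap_apply_of_ne_of_ne e1 e2, if_neg (by tauto)]
  rw [mem_perfectMatchings]
  constructor
  · intro v
    rw [hval v]
    split_ifs with h
    · rw [hval v, if_pos h]
    · rw [hval, if_neg, h1]
      rintro (e | e)
      · exact h (Or.inr (by rw [← e, h1]))
      · exact h (Or.inl (d.injective e))
  · intro v
    rw [hval v, Finset.mem_erase, Finset.mem_erase, ← h2 v]
    split_ifs with h <;> tauto

lemma mul_swap_mem_perfectMatchings' {A : Finset V} {d : Equiv.Perm V} {a q : V}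
    (ha : a ∈ A) (hq : q ∈ A.erase a) (hd : d ∈ perfectMatchings ((A.erase a).erase q)) :
    d * Equiv.swap a q ∈ perfectMatchings A ∧ (d * Equiv.swap a q) a = q := by
  obtain ⟨h1, h2⟩ := mem_perfectMatchings.1 hd
  obtain ⟨hqa, hqA⟩ := Finset.mem_erase.1 hq
  have hda : d a = a := by
    by_contra h
    simpa using (h2 a).1 h
  have hdq : d q = q := by
    by_contra h
    simpa using (h2 q).1 h
  have hval : ∀ v, (d * Equiv.swap a q) v = if v = a then q else if v = q then a else d v := by
    intro v
    rw [Equiv.Perm.mul_apply]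
    by_cases e1 : v = a
    · subst e1; simp [hdq]
    by_cases e2 : v = q
    · subst e2; simp [hda, e1]
    · rw [Equiv.swap_apply_of_ne_of_ne e1 e2, if_neg e1, if_neg e2]
  refine ⟨mem_perfectMatchings.2 ⟨fun v => ?_, fun v => ?_⟩, by rw [hval, if_pos rfl]⟩
  · rw [hval v]
    split_ifs with e1 e2
    · rw [hval, if_neg hqa, if_pos rfl, e1]
    · rw [hval, if_pos rfl, e2]
    · rw [hval, if_neg, if_neg, h1]
      · exact fun e => e2 (d.injective (e.trans hdq.symm))
      · exact fun e => e1 (d.injective (e.trans hda.symm))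
  · rw [hval v]
    have := h2 v
    simp only [Finset.mem_erase] at this
    split_ifs with e1 e2
    · subst e1; simpa [ha] using hqa
    · subst e2; simpa [hqA] using hqa.symm
    · rw [this]; tauto

/-- A perfect matching of `A` consists of the partner `q` of a chosen point `a` and a perfect
matching of the other points. -/
lemma sum_perfectMatchings {M : Type*} [AddCommMonoid M] {A : Finset V} {a : V} (ha : a ∈ A)
    (F : Equiv.Perm V → M) : ∑ d ∈ perfectMatchings A, F d =
      ∑ q ∈ A.erase a, ∑ d ∈ perfectMatchings ((A.erase a).erase q), F (d * Equiv.swap a q) := by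
  rw [Finset.sum_sigma']
  refine Finset.sum_bij' (fun d _ => (⟨d a, d * Equiv.swap a (d a)⟩ : (_ : V) × Equiv.Perm V))
    (fun p _ => p.2 * Equiv.swap a p.1) ?_ ?_ ?_ ?_ ?_
  · intro d hd
    refine Finset.mem_sigma.2 ⟨?_, mul_swap_mem_perfectMatchings hd ha⟩
    obtain ⟨h1, h2⟩ := mem_perfectMatchings.1 hd
    refine Finset.mem_erase.2 ⟨(h2 a).2 ha, (h2 _).1 ?_⟩
    rw [h1]
    exact ((h2 a).2 ha).symm
  · rintro ⟨q, d⟩ h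
    obtain ⟨hq, hd⟩ := Finset.mem_sigma.1 h
    exact (mul_swap_mem_perfectMatchings' ha hq hd).1
  · intro d _
    simp [mul_assoc]
  · rintro ⟨q, d⟩ h
    obtain ⟨hq, hd⟩ := Finset.mem_sigma.1 h
    have e := (mul_swap_mem_perfectMatchings' ha hq hd).2
    simp only at e
    ext : 1
    · exact e
    · simp only [e, heq_eq_eq, mul_assoc, Equiv.swap_mul_self, mul_one]
  · intro d _
    simp [mul_assoc]

open MvPolynomial Wick in
/-- Wick's theorem. The weight of an edge with the ends `v`, `v'` is written as the product of
`g (c v) (c v')` and `g (c v') (c v)`. -/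
theorem expect_prod_X {ι R : Type*} [Fintype ι] [CommRing R] [Algebra ℚ R]
    (g : ι → ι → R) (c : V → ι) (k : ℕ) (A : Finset V) (hA : A.card = 2 * k) :
    expect (fun i j => g i j * g j i) k (∏ v ∈ A, X (c v)) =
      ∑ d ∈ perfectMatchings A, ∏ v ∈ A, g (c v) (c (d v)) := by
  induction k generalizing A with
  | zero =>
    obtain rfl : A = ∅ := by simpa using hA
    simp [perfectMatchings_empty, expect_one]
  | succ k ih =>
    obtain ⟨a, ha⟩ : A.Nonempty := by
      rw [← Finset.card_pos]
      omega
    rw [← Finset.mul_prod_erase A _ ha, expect_X_mul fun i j => mul_comm _ _, derivation_prod,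
      map_sum, sum_perfectMatchings ha]
    refine Finset.sum_congr rfl fun q hq => ?_
    obtain ⟨hqa, hqA⟩ := Finset.mem_erase.1 hq
    rw [contract_X, mul_comm, ← MvPolynomial.smul_eq_C_mul, map_smul, ih, smul_eq_mul,
      Finset.mul_sum]
    · refine Finset.sum_congr rfl fun d hd => ?_
      have hval : ∀ v ∈ (A.erase a).erase q, (d * Equiv.swap a q) v = d v := by
        intro v hv
        simp only [Finset.mem_erase] at hv
        rw [Equiv.Perm.mul_apply, Equiv.swap_apply_of_ne_of_ne hv.2.1 hv.1]
      obtain ⟨h1, h2⟩ := mul_swap_mem_perfectMatchings' ha hq hd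
      have h3 : (d * Equiv.swap a q) q = a := by
        have := (mem_perfectMatchings.1 h1).1 a
        rwa [h2] at this
      rw [← Finset.mul_prod_erase A _ ha, ← Finset.mul_prod_erase (A.erase a) _ hq, h2, h3,
        mul_assoc]
      congr 2
      exact Finset.prod_congr rfl fun v hv => by rw [hval v hv]
    · rw [Finset.card_erase_of_mem hq, Finset.card_erase_of_mem ha, hA]
      omega

end PerfectMatchings

/-! ### Moments of the quadratic forms of the orthogonal case -/

namespace Wick

open MvPolynomial

variable {N : ℕ} {R : Type*} [CommRing R]

/-- The weight of an end of an edge of a labelled diagram. The variables `inl i` and `inr i` stand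
for a top dot and for a bottom dot with the label `i`. A vertical edge joins equal labels, and a
horizontal edge joins `i` to `i'`; each end of a horizontal edge of the bottom row gets an extra
factor `s`. -/
def edgeWeight (s : R) : Fin N ⊕ Fin N → Fin N ⊕ Fin N → R
  | Sum.inl i, Sum.inl j => if j = Fin.rev i then 1 else 0
  | Sum.inl i, Sum.inr j => if j = i then 1 else 0
  | Sum.inr i, Sum.inl j => if j = i then 1 else 0
  | Sum.inr i, Sum.inr j => if j = Fin.rev i then s else 0

/-- The covariances for which Wick's theorem sums over the labelled diagrams. -/
def covariance (s : R) (a b : Fin N ⊕ Fin N) : R := edgeWeight s a b * edgeWeight s b a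

lemma covariance_comm (s : R) (a b : Fin N ⊕ Fin N) : covariance s a b = covariance s b a :=
  mul_comm _ _

lemma covariance_inl_inl (s : R) (i j : Fin N) :
    covariance s (Sum.inl i) (Sum.inl j) = if j = Fin.rev i then 1 else 0 := by
  simp only [covariance, edgeWeight]
  by_cases h : j = i.rev <;> simp [h]

lemma covariance_inl_inr (s : R) (i j : Fin N) :
    covariance s (Sum.inl i) (Sum.inr j) = if j = i then 1 else 0 := by
  simp only [covariance, edgeWeight, eq_comm (a := i)]
  by_cases h : j = i <;> simp [h]

lemma covariance_inr_inl (s : R) (i j : Fin N) :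
    covariance s (Sum.inr i) (Sum.inl j) = if j = i then 1 else 0 := by
  simp only [covariance, edgeWeight, eq_comm (a := i)]
  by_cases h : j = i <;> simp [h]

lemma covariance_inr_inr (s : R) (i j : Fin N) :
    covariance s (Sum.inr i) (Sum.inr j) = if j = Fin.rev i then s ^ 2 else 0 := by
  simp only [covariance, edgeWeight]
  by_cases h : j = i.rev <;> simp [h, sq]

/-- The quadratic form `u_p v_p - u_{p'} v_{p'}`, where `u`, `v` are the variables of the top dots
and of the bottom dots. -/
def pairForm (R : Type*) [CommRing R] (p : Fin N) : MvPolynomial (Fin N ⊕ Fin N) R :=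
  X (Sum.inl p) * X (Sum.inr p) - X (Sum.inl (Fin.rev p)) * X (Sum.inr (Fin.rev p))

lemma contract_pairForm_of_ne (s : R) {p : Fin N} {a : Fin N ⊕ Fin N}
    (h1 : a ≠ Sum.inl p) (h2 : a ≠ Sum.inl (Fin.rev p)) (h3 : a ≠ Sum.inr p)
    (h4 : a ≠ Sum.inr (Fin.rev p)) : contract (covariance s) a (pairForm R p) = 0 := by
  rw [pairForm, map_sub, Derivation.leibniz, Derivation.leibniz]
  simp only [contract_X, smul_eq_mul]
  rcases a with i | i
  · simp only [ne_eq, Sum.inl.injEq] at h1 h2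
    have h1' : ¬ p = i := fun e => h1 e.symm
    have h2' : ¬ p.rev = i := fun e => h2 e.symm
    have h5 : ¬ p = i.rev := fun e => h2 (by rw [e, Fin.rev_rev])
    simp [covariance_inl_inl, covariance_inl_inr, h1', h2', h5, Fin.rev_inj]
  · simp only [ne_eq, Sum.inr.injEq] at h3 h4
    have h1' : ¬ p = i := fun e => h3 e.symm
    have h2' : ¬ p.rev = i := fun e => h4 e.symm
    have h5 : ¬ p = i.rev := fun e => h4 (by rw [e, Fin.rev_rev])
    simp [covariance_inr_inl, covariance_inr_inr, h1', h2', h5, Fin.rev_inj]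

lemma contract_pairForm (s : R) {p : Fin N} (hp : Fin.rev p ≠ p) :
    contract (covariance s) (Sum.inl p) (pairForm R p) = X (Sum.inl p) - X (Sum.inr p.rev) ∧
    contract (covariance s) (Sum.inl p.rev) (pairForm R p) = X (Sum.inr p) - X (Sum.inl p.rev) ∧
    contract (covariance s) (Sum.inr p) (pairForm R p) =
      X (Sum.inr p) - MvPolynomial.C (s ^ 2) * X (Sum.inl p.rev) ∧
    contract (covariance s) (Sum.inr p.rev) (pairForm R p) =
      MvPolynomial.C (s ^ 2) * X (Sum.inl p) - X (Sum.inr p.rev) := by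
  refine ⟨?_, ?_, ?_, ?_⟩ <;> rw [pairForm, map_sub, Derivation.leibniz, Derivation.leibniz] <;>
    simp only [contract_X, smul_eq_mul, covariance_inl_inl, covariance_inl_inr, covariance_inr_inl,
      covariance_inr_inr, Fin.rev_rev, hp, hp.symm, if_true, if_false, map_one, map_zero] <;> ring

variable [Algebra ℚ R]

/-- The Wick contraction of the variable `a` in a product `a b q^k f`, where `q` is the quadratic
form of `p` and `f` does not involve the variables of `p`. -/
lemma expect_X_mul_X_mul_pow (s : R) {p : Fin N} {f : MvPolynomial (Fin N ⊕ Fin N) R}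
    {a b : Fin N ⊕ Fin N} (hfa : contract (covariance s) a f = 0) (K k : ℕ) :
    expect (covariance s) (K + 1) (X a * (X b * pairForm R p ^ k * f)) =
      expect (covariance s) K (MvPolynomial.C (covariance s a b) * (pairForm R p ^ k * f) +
        (k : MvPolynomial (Fin N ⊕ Fin N) R) * (X b * (contract (covariance s) a (pairForm R p)) *
          pairForm R p ^ (k - 1) * f)) := by
  rw [expect_X_mul (covariance_comm s)]
  congr 1
  rw [Derivation.leibniz, hfa, Derivation.leibniz, Derivation.leibniz_pow, contract_X]
  simp only [smul_eq_mul, nsmul_eq_mul]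
  ring

/-- Two contractions lower the power of the quadratic form by two. -/
lemma expect_pairForm_pow_add_two (s : R) {p : Fin N} (hp : Fin.rev p ≠ p)
    {f : MvPolynomial (Fin N ⊕ Fin N) R}
    (hf : ∀ a : Fin N ⊕ Fin N, a = Sum.inl p ∨ a = Sum.inl (Fin.rev p) ∨ a = Sum.inr p ∨
      a = Sum.inr (Fin.rev p) → contract (covariance s) a f = 0) (K k : ℕ) :
    expect (covariance s) (K + 2) (pairForm R p ^ (k + 2) * f) =
      (k + 2) * (k + 1) * (1 - s ^ 2) * expect (covariance s) K (pairForm R p ^ k * f) := by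
  obtain ⟨hu, hu', hv, hv'⟩ := contract_pairForm s hp
  have fu := hf (Sum.inl p) (by simp)
  have fu' := hf (Sum.inl p.rev) (by simp)
  have fv := hf (Sum.inr p) (by simp)
  have fv' := hf (Sum.inr p.rev) (by simp)
  set q := pairForm R p with hq
  obtain ⟨u, u_def⟩ : ∃ u : MvPolynomial (Fin N ⊕ Fin N) R, u = X (Sum.inl p) := ⟨_, rfl⟩
  obtain ⟨u', u'_def⟩ : ∃ u : MvPolynomial (Fin N ⊕ Fin N) R, u = X (Sum.inl p.rev) := ⟨_, rfl⟩
  obtain ⟨v, v_def⟩ : ∃ u : MvPolynomial (Fin N ⊕ Fin N) R, u = X (Sum.inr p) := ⟨_, rfl⟩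
  obtain ⟨v', v'_def⟩ : ∃ u : MvPolynomial (Fin N ⊕ Fin N) R, u = X (Sum.inr p.rev) := ⟨_, rfl⟩
  have hquv : q = u * v - u' * v' := by rw [hq, pairForm, u_def, u'_def, v_def, v'_def]
  -- Wick's rule for the four variables
  have wu := fun K k => expect_X_mul_X_mul_pow s (b := Sum.inr p) fu K k (p := p)
  have wu' := fun K k => expect_X_mul_X_mul_pow s (b := Sum.inr p.rev) fu' K k (p := p)
  have wv := fun K k => expect_X_mul_X_mul_pow s (b := Sum.inr p.rev) fv K k (p := p)
  have wv' := fun K k => expect_X_mul_X_mul_pow s (b := Sum.inr p) fv' K k (p := p)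
  simp only [← hq, hu, hu', hv, hv', covariance_inl_inr, covariance_inr_inr, Fin.rev_rev, if_true,
    map_one, one_mul, ← u_def, ← u'_def, ← v_def, ← v'_def] at wu wu' wv wv'
  have hk : ∀ k : ℕ, (k : MvPolynomial (Fin N ⊕ Fin N) R) * q * q ^ (k - 1) = k * q ^ k := by
    rintro (_ | k)
    · simp
    · rw [Nat.add_sub_cancel, pow_succ]
      ring
  have hsum : expect (covariance s) (K + 1) ((u * v + u' * v') * q ^ k * f) =
      (k + 2) * expect (covariance s) K (q ^ k * f) := by
    have e : (u * v + u' * v') * q ^ k * f = u * (v * q ^ k * f) + u' * (v' * q ^ k * f) := by ring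
    rw [e, map_add, wu, wu', ← map_add, mul_expect]
    congr 1
    simp only [map_add, map_natCast, map_ofNat]
    linear_combination f * hk k - k * q ^ (k - 1) * f * hquv
  have hvv : 2 * expect (covariance s) (K + 1) (v * v' * q ^ k * f) =
      s ^ 2 * (k + 2) * expect (covariance s) K (q ^ k * f) := by
    have e1 : v * v' * q ^ k * f = v * (v' * q ^ k * f) := by ring
    have e2 : v * v' * q ^ k * f = v' * (v * q ^ k * f) := by ring
    rw [two_mul]
    nth_rw 1 [e1]
    rw [e2, wv, wv', ← map_add, mul_expect]
    congr 1
    simp only [map_add, map_mul, map_natCast, map_ofNat]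
    linear_combination MvPolynomial.C (s ^ 2) * (f * hk k - k * q ^ (k - 1) * f * hquv)
  have hdiff : expect (covariance s) (K + 2) (q ^ (k + 2) * f) =
      (k + 1) * (expect (covariance s) (K + 1) ((u * v + u' * v') * q ^ k * f) -
        2 * expect (covariance s) (K + 1) (v * v' * q ^ k * f)) := by
    have e : q ^ (k + 2) * f = u * (v * q ^ (k + 1) * f) - u' * (v' * q ^ (k + 1) * f) := by
      linear_combination q ^ (k + 1) * f * hquv
    rw [e, map_sub, wu, wu', ← map_sub, mul_expect, ← map_sub, mul_expect]
    congr 1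
    simp only [map_add, map_natCast, map_ofNat, map_one, Nat.add_sub_cancel, Nat.cast_add,
      Nat.cast_one]
    ring
  rw [hdiff, hsum, hvv]
  ring

lemma expect_pairForm (s : R) {p : Fin N} {f : MvPolynomial (Fin N ⊕ Fin N) R}
    (hf : ∀ a : Fin N ⊕ Fin N, a = Sum.inl p ∨ a = Sum.inl (Fin.rev p) ∨ a = Sum.inr p ∨
      a = Sum.inr (Fin.rev p) → contract (covariance s) a f = 0) (K : ℕ) :
    expect (covariance s) (K + 1) (pairForm R p * f) = 0 := by
  have wu := expect_X_mul_X_mul_pow s (b := Sum.inr p) (hf (Sum.inl p) (by simp)) K 0 (p := p)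
  have wu' := expect_X_mul_X_mul_pow s (b := Sum.inr p.rev) (hf (Sum.inl p.rev) (by simp)) K 0
    (p := p)
  have e : pairForm R p * f = X (Sum.inl p) * (X (Sum.inr p) * pairForm R p ^ 0 * f) -
      X (Sum.inl p.rev) * (X (Sum.inr p.rev) * pairForm R p ^ 0 * f) := by
    rw [pairForm]
    ring
  rw [e, map_sub, wu, wu', covariance_inl_inr, covariance_inl_inr]
  simp

/-- The moments of the quadratic forms `pairForm`. -/
def moment (s : R) (k : ℕ) : R :=
  if Even k then (k.factorial : R) * (1 - s ^ 2) ^ (k / 2) else 0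

lemma expect_pairForm_pow (s : R) {p : Fin N} (hp : Fin.rev p ≠ p)
    {f : MvPolynomial (Fin N ⊕ Fin N) R}
    (hf : ∀ a : Fin N ⊕ Fin N, a = Sum.inl p ∨ a = Sum.inl (Fin.rev p) ∨ a = Sum.inr p ∨
      a = Sum.inr (Fin.rev p) → contract (covariance s) a f = 0) (K k : ℕ) :
    expect (covariance s) (K + k) (pairForm R p ^ k * f) =
      moment s k * expect (covariance s) K f := by
  induction k using Nat.twoStepInduction with
  | zero => simp [moment]
  | one => simp [moment, expect_pairForm s hf]
  | more k ih _ =>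
    have e : moment s (k + 2) = (k + 2) * (k + 1) * (1 - s ^ 2) * moment s k := by
      have hpar : Even (k + 2) ↔ Even k := by simp [Nat.even_add]
      simp only [moment, hpar]
      split_ifs
      · rw [Nat.factorial_succ, Nat.factorial_succ, show (k + 2) / 2 = k / 2 + 1 by omega]
        push_cast
        ring
      · simp
    rw [← add_assoc, expect_pairForm_pow_add_two s hp hf (K + k) k, ih, e]
    ring

lemma expect_prod_pairForm_pow {J : Type*} [DecidableEq J] (s : R) {p : J → Fin N}
    (hinj : Function.Injective p) (hrev : ∀ i j, Fin.rev (p i) ≠ p j) (k : J → ℕ) (A : Finset J) :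
    expect (covariance s) (∑ j ∈ A, k j) (∏ j ∈ A, pairForm R (p j) ^ k j) =
      ∏ j ∈ A, moment s (k j) := by
  induction A using Finset.induction_on with
  | empty => simp [expect_one]
  | insert j A hj ih =>
    rw [Finset.sum_insert hj, Finset.prod_insert hj, Finset.prod_insert hj, add_comm,
      expect_pairForm_pow s (hrev j j), ih]
    intro a ha
    rw [derivation_prod]
    refine Finset.sum_eq_zero fun i hi => ?_
    have hij : p i ≠ p j := fun e => hj (hinj e ▸ hi)
    have h1 := hrev i j
    have h2 := hrev j i
    rw [Derivation.leibniz_pow, contract_pairForm_of_ne, smul_zero, smul_zero, mul_zero] <;>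
      rcases ha with rfl | rfl | rfl | rfl <;> simp [hij.symm, h1.symm, h2]

/-- The expectation of a power of a combination of the independent forms `pairForm`. -/
lemma expect_sum_pairForm_pow {J : Type*} [Fintype J] [DecidableEq J] (s : R) {p : J → Fin N}
    (hinj : Function.Injective p) (hrev : ∀ i j, Fin.rev (p i) ≠ p j) (y : J → R) (l : ℕ) :
    expect (covariance s) (2 * l) ((∑ j, MvPolynomial.C (y j) * pairForm R (p j)) ^ (2 * l)) =
      ((2 * l).factorial : R) * (1 - s ^ 2) ^ l *
        ∑ k ∈ Finset.piAntidiag Finset.univ l, ∏ j, (y j ^ 2) ^ k j := by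
  have hterm : ∀ k ∈ Finset.piAntidiag (Finset.univ : Finset J) (2 * l),
      expect (covariance s) (2 * l) ((Nat.multinomial Finset.univ k : MvPolynomial _ R) *
        ∏ j, (MvPolynomial.C (y j) * pairForm R (p j)) ^ k j) =
      if ∀ j, Even (k j) then ((2 * l).factorial : R) * (1 - s ^ 2) ^ l * ∏ j, y j ^ k j
      else 0 := by
    intro k hk
    have hsum : ∑ j, k j = 2 * l := (Finset.mem_piAntidiag.1 hk).1
    have e : (Nat.multinomial Finset.univ k : MvPolynomial (Fin N ⊕ Fin N) R) *
        ∏ j, (MvPolynomial.C (y j) * pairForm R (p j)) ^ k j =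
        ((Nat.multinomial Finset.univ k : R) * ∏ j, y j ^ k j) • ∏ j, pairForm R (p j) ^ k j := by
      rw [MvPolynomial.smul_eq_C_mul, map_mul, map_prod, map_natCast, mul_assoc,
        ← Finset.prod_mul_distrib]
      simp only [mul_pow, map_pow]
    rw [e, map_smul, smul_eq_mul, ← hsum, expect_prod_pairForm_pow s hinj hrev]
    split_ifs with heven
    · have h1 : ∏ j, moment s (k j) = (∏ j, ((k j).factorial : R)) * (1 - s ^ 2) ^ l := by
        simp only [moment, heven, if_true, Finset.prod_mul_distrib, Finset.prod_pow_eq_pow_sum]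
        congr 2
        have : ∑ j, k j = 2 * ∑ j, k j / 2 := by
          rw [Finset.mul_sum]
          exact Finset.sum_congr rfl fun j _ => (Nat.two_mul_div_two_of_even (heven j)).symm
        omega
      have h2 : ((∑ j, k j).factorial : R) =
          (∏ j, ((k j).factorial : R)) * Nat.multinomial Finset.univ k := by
        rw [← Nat.multinomial_spec]
        push_cast
        rfl
      rw [h1, h2]
      ring
    · obtain ⟨j, hj⟩ := not_forall.1 heven
      have h0 : moment s (k j) = 0 := if_neg hj
      rw [show ∏ j, moment s (k j) = 0 from Finset.prod_eq_zero (Finset.mem_univ j) h0, mul_zero]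
  rw [Finset.sum_pow_eq_sum_piAntidiag, map_sum, Finset.sum_congr rfl hterm, ← Finset.sum_filter,
    ← Finset.mul_sum]
  congr 1
  refine Finset.sum_bij' (fun k _ j => k j / 2) (fun k _ j => 2 * k j) ?_ ?_ ?_ ?_ ?_
  · intro k hk
    obtain ⟨h1, h2⟩ := Finset.mem_filter.1 hk
    have h3 : ∑ j, k j = 2 * l := (Finset.mem_piAntidiag.1 h1).1
    refine Finset.mem_piAntidiag.2 ⟨?_, fun _ _ => Finset.mem_univ _⟩
    have : ∑ j, k j = 2 * ∑ j, k j / 2 := by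
      rw [Finset.mul_sum]
      exact Finset.sum_congr rfl fun j _ => (Nat.two_mul_div_two_of_even (h2 j)).symm
    omega
  · intro k hk
    have h3 := (Finset.mem_piAntidiag.1 hk).1
    refine Finset.mem_filter.2 ⟨Finset.mem_piAntidiag.2 ⟨?_, fun _ _ => Finset.mem_univ _⟩,
      fun j => even_two_mul _⟩
    rw [← Finset.mul_sum, h3]
  · intro k hk
    funext j
    exact Nat.two_mul_div_two_of_even ((Finset.mem_filter.1 hk).2 j)
  · intro k _
    funext j
    simp
  · intro k hk
    refine Finset.prod_congr rfl fun j _ => ?_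
    rw [← pow_mul, Nat.two_mul_div_two_of_even ((Finset.mem_filter.1 hk).2 j)]

end Wick

/-! ### The characteristic of the symmetrizer -/

namespace BrauerAlgebra

open BrauerDiagram

section Trace

variable {m : ℕ} (N n : ℕ)

/-- The diagonal entries of the matrix `Y`. -/
def cartanEntry (i : Fin N) : MvPolynomial (Fin n) ℂ :=
  if h : (i : ℕ) < n then MvPolynomial.X ⟨i, h⟩
  else if h : (Fin.rev i : ℕ) < n then -MvPolynomial.X ⟨Fin.rev i, h⟩
  else 0

/-- A labelling of the columns that satisfies the conditions of all the edges of a diagram whose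
top row and bottom row are both labelled by `I`. -/
def IsCompatible {N : ℕ} (d : BrauerDiagram m) (I : Fin m → Fin N) : Prop :=
  ∀ v : BrauerDots m, Sum.elim I I (d.1 v) =
    if (d.1 v).isLeft = v.isLeft then Fin.rev (Sum.elim I I v) else Sum.elim I I v

instance {N : ℕ} (d : BrauerDiagram m) (I : Fin m → Fin N) : Decidable (IsCompatible d I) :=
  inferInstanceAs (Decidable (∀ _, _))

/-- The trace of `d Y_1 ⋯ Y_m`. -/
def diagramTrace (d : BrauerDiagram m) : MvPolynomial (Fin n) ℂ :=
  ∑ I : Fin m → Fin N, if IsCompatible d I then ∏ a, cartanEntry N n (I a) else 0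

lemma tensorPower_cartanMatrix (I J : Fin m → Fin N) :
    tensorPower m (cartanMatrix N n) I J = if I = J then ∏ a, cartanEntry N n (I a) else 0 := by
  simp only [tensorPower, cartanMatrix, Matrix.diagonal_apply]
  split_ifs with h
  · subst h
    exact Finset.prod_congr rfl fun a _ => if_pos rfl
  · obtain ⟨a, ha⟩ := Function.ne_iff.1 h
    exact Finset.prod_eq_zero (Finset.mem_univ a) (if_neg ha)

lemma characteristicMap_eq (f : BrauerAlgebra ℂ (N : ℂ) m) :
    characteristicMap N n f = MvPolynomial.C (1 / (m.factorial : ℂ)) *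
      ∑ d, MvPolynomial.C (f d) * diagramTrace N n d := by
  rw [characteristicMap]
  congr 1
  simp only [Matrix.trace, Matrix.diag_apply, Matrix.mul_apply, tensorPower_cartanMatrix,
    mul_ite, mul_zero, Finset.sum_ite_eq', Finset.mem_univ, if_true, Matrix.map_apply, action,
    Matrix.sum_apply, Matrix.smul_apply, map_sum, smul_eq_mul, map_mul, Finset.sum_mul,
    diagramTrace, Finset.mul_sum]
  rw [Finset.sum_comm]
  refine Finset.sum_congr rfl fun d _ => Finset.sum_congr rfl fun I _ => ?_
  by_cases h : IsCompatible d I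
  · have e : diagramMatrix N d I I = 1 := if_pos h
    rw [e, if_pos h, map_one, _root_.mul_one]
  · have e : diagramMatrix N d I I = 0 := if_neg h
    rw [e, if_neg h, map_zero, mul_zero, zero_mul]

lemma edgeWeight_map {R : Type*} [CommRing R] (s : R) {N : ℕ} (I : Fin m → Fin N)
    (v w : BrauerDots m) :
    Wick.edgeWeight s (Sum.map I I v) (Sum.map I I w) =
      if Sum.elim I I w = (if w.isLeft = v.isLeft then Fin.rev (Sum.elim I I v) else
        Sum.elim I I v) then (if v.isRight ∧ w.isRight then s else 1) else 0 := by
  rcases v with i | i <;> rcases w with j | j <;> simp [Wick.edgeWeight]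

lemma prod_edgeWeight {R : Type*} [CommRing R] (s : R) {N : ℕ} (I : Fin m → Fin N)
    (d : BrauerDiagram m) :
    ∏ v, Wick.edgeWeight s (Sum.map I I v) (Sum.map I I (d.1 v)) =
      if IsCompatible d I then s ^ bottomCount d else 0 := by
  simp only [edgeWeight_map]
  rw [Finset.prod_ite_zero]
  simp only [Finset.mem_univ, true_implies]
  refine if_congr Iff.rfl ?_ rfl
  rw [Fintype.prod_sum_type]
  simp only [Sum.isRight_inl, Bool.false_eq_true, false_and, if_false, Finset.prod_const_one,
    one_mul, Sum.isRight_inr, true_and]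
  rw [← Finset.prod_filter, Finset.prod_const, bottomCount]

lemma sum_perfectMatchings_univ {M : Type*} [AddCommMonoid M]
    (F : (BrauerDots m → BrauerDots m) → M) :
    ∑ d ∈ perfectMatchings (Finset.univ : Finset (BrauerDots m)), F d =
      ∑ d : BrauerDiagram m, F d.1 := by
  refine Finset.sum_bij' (fun d hd => ⟨d, fun v => ?_⟩)
    (fun d _ => (show Function.Involutive d.1 from d.apply_apply).toPerm) ?_ ?_ ?_ ?_ ?_
  · obtain ⟨h1, h2⟩ := mem_perfectMatchings.1 hd
    exact ⟨(h2 v).2 (Finset.mem_univ v), h1 v⟩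
  · exact fun _ _ => Finset.mem_univ _
  · intro d _
    exact mem_perfectMatchings.2 ⟨d.apply_apply, fun v =>
      ⟨fun _ => Finset.mem_univ v, fun _ => (d.2 v).1⟩⟩
  · intro d _
    ext v
    rfl
  · intro d _
    rfl
  · intro d _
    rfl

/-- The generating function of the traces of the diagrams is the expectation of a power of a
quadratic form. -/
lemma sum_X_pow_mul_diagramTrace :
    ∑ d : BrauerDiagram m, (X : (MvPolynomial (Fin n) ℂ)[X]) ^ bottomCount d *
        C (diagramTrace N n d) =
      Wick.expect (Wick.covariance X) m
        ((∑ i : Fin N, MvPolynomial.C (C (cartanEntry N n i)) *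
          (MvPolynomial.X (Sum.inl i) * MvPolynomial.X (Sum.inr i))) ^ m) := by
  have hI : ∀ I : Fin m → Fin N, Wick.expect (Wick.covariance X) m
      (∏ a, MvPolynomial.C (C (cartanEntry N n (I a))) *
          (MvPolynomial.X (Sum.inl (I a)) * MvPolynomial.X (Sum.inr (I a)))) =
      ∑ d : BrauerDiagram m, if IsCompatible d I then
        X ^ bottomCount d * C (∏ a, cartanEntry N n (I a)) else 0 := by
    intro I
    have e1 : ∏ a, (MvPolynomial.C (C (cartanEntry N n (I a))) *
          (MvPolynomial.X (Sum.inl (I a)) * MvPolynomial.X (Sum.inr (I a)))) =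
        C (∏ a, cartanEntry N n (I a)) •
          ∏ v : BrauerDots m, MvPolynomial.X (Sum.map I I v) := by
      rw [MvPolynomial.smul_eq_C_mul, Fintype.prod_sum_type, Finset.prod_mul_distrib,
        Finset.prod_mul_distrib, map_prod, map_prod]
      rfl
    have e2 := expect_prod_X (Wick.edgeWeight (X : (MvPolynomial (Fin n) ℂ)[X]))
      (Sum.map I I : BrauerDots m → _) m Finset.univ (by simp [two_mul])
    rw [e1, map_smul, smul_eq_mul]
    refine (congrArg _ e2).trans ?_
    rw [sum_perfectMatchings_univ fun d =>
      ∏ v, Wick.edgeWeight X (Sum.map I I v) (Sum.map I I (d v)), Finset.mul_sum]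
    refine Finset.sum_congr rfl fun d _ => ?_
    rw [prod_edgeWeight, mul_ite, mul_zero, mul_comm]
  rw [Fintype.sum_pow, map_sum, Finset.sum_congr rfl fun I _ => hI I, Finset.sum_comm]
  refine Finset.sum_congr rfl fun d _ => ?_
  rw [diagramTrace, map_sum, Finset.mul_sum]
  refine Finset.sum_congr rfl fun I _ => ?_
  split_ifs <;> simp

variable {N n}

/-- The labels of the entries `y_1, …, y_n` of `Y`. -/
def positiveLabel (hn : 2 * n ≤ N) (j : Fin n) : Fin N := ⟨j, by omega⟩

lemma cartanEntry_eq_sum (hn : 2 * n ≤ N) (i : Fin N) :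
    cartanEntry N n i = ∑ j : Fin n, ((if i = positiveLabel hn j then MvPolynomial.X j else 0) -
      if i = (positiveLabel hn j).rev then MvPolynomial.X j else 0) := by
  rw [Finset.sum_sub_distrib, cartanEntry]
  have h1 : ∀ j : Fin n, i = positiveLabel hn j ↔ (j : ℕ) = i := by
    intro j
    simp [Fin.ext_iff, positiveLabel, eq_comm]
  have h2 : ∀ j : Fin n, i = (positiveLabel hn j).rev ↔ (j : ℕ) = i.rev := by
    intro j
    simp only [Fin.ext_iff, positiveLabel, Fin.val_rev]
    omega
  simp only [h1, h2]
  have h3 : ∀ k : ℕ, (∑ j : Fin n, if (j : ℕ) = k then (MvPolynomial.X j : MvPolynomial (Fin n) ℂ)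
      else 0) = if h : k < n then MvPolynomial.X ⟨k, h⟩ else 0 := by
    intro k
    split_ifs with h
    · rw [Finset.sum_eq_single ⟨k, h⟩]
      · simp
      · intro j _ hj
        exact if_neg fun e => hj (Fin.ext e)
      · simp
    · exact Finset.sum_eq_zero fun j _ => if_neg (by omega)
  rw [h3, h3]
  have h4 : (i : ℕ) < n → ¬ (i.rev : ℕ) < n := by
    rw [Fin.val_rev]
    omega
  by_cases h5 : (i : ℕ) < n
  · rw [dif_pos h5, dif_pos h5, dif_neg (h4 h5), sub_zero]
  · rw [dif_neg h5, dif_neg h5, zero_sub]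
    split_ifs
    · rfl
    · exact neg_zero.symm

lemma sum_C_mul_eq_sum_pairForm {R : Type*} [CommRing R] (hn : 2 * n ≤ N) (y : Fin n → R) :
    ∑ i : Fin N, MvPolynomial.C (∑ j : Fin n, ((if i = positiveLabel hn j then y j else 0) -
        if i = (positiveLabel hn j).rev then y j else 0)) *
        (MvPolynomial.X (Sum.inl i) * MvPolynomial.X (Sum.inr i)) =
      ∑ j : Fin n, MvPolynomial.C (y j) * Wick.pairForm R (positiveLabel hn j) := by
  simp only [map_sum, map_sub, Finset.sum_mul, _root_.sub_mul, Wick.pairForm, _root_.mul_sub]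
  rw [Finset.sum_comm]
  refine Finset.sum_congr rfl fun j _ => ?_
  rw [Finset.sum_sub_distrib]
  congr 1
  · rw [Finset.sum_eq_single (positiveLabel hn j)]
    · simp
    · intro i _ hi
      simp [hi]
    · simp
  · rw [Finset.sum_eq_single (positiveLabel hn j).rev]
    · simp
    · intro i _ hi
      simp [hi]
    · simp

lemma sum_cartanEntry (hn : 2 * n ≤ N) :
    ∑ i : Fin N, MvPolynomial.C (C (cartanEntry N n i)) *
        (MvPolynomial.X (Sum.inl i) * MvPolynomial.X (Sum.inr i)) =
      ∑ j : Fin n, MvPolynomial.C (C (MvPolynomial.X j : MvPolynomial (Fin n) ℂ)) *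
        Wick.pairForm (MvPolynomial (Fin n) ℂ)[X] (positiveLabel hn j) := by
  rw [← sum_C_mul_eq_sum_pairForm hn]
  refine Finset.sum_congr rfl fun i _ => ?_
  rw [cartanEntry_eq_sum hn, map_sum]
  congr 2
  refine Finset.sum_congr rfl fun j _ => ?_
  rw [map_sub, apply_ite C, apply_ite C, map_zero]

lemma aeval_sq_hsymm (n l : ℕ) :
    MvPolynomial.aeval (fun i : Fin n => (MvPolynomial.X i : MvPolynomial (Fin n) ℂ) ^ 2)
      (MvPolynomial.hsymm (Fin n) ℂ l) =
      ∑ k ∈ Finset.piAntidiag Finset.univ l, ∏ j,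
        ((MvPolynomial.X j : MvPolynomial (Fin n) ℂ) ^ 2) ^ k j := by
  rw [MvPolynomial.hsymm, map_sum]
  have h1 : ∀ s : Sym (Fin n) l, MvPolynomial.aeval
      (fun i : Fin n => (MvPolynomial.X i : MvPolynomial (Fin n) ℂ) ^ 2)
      (s.1.map (MvPolynomial.X : Fin n → MvPolynomial (Fin n) ℂ)).prod = ∏ j,
        ((MvPolynomial.X j : MvPolynomial (Fin n) ℂ) ^ 2) ^ ((Sym.equivNatSumOfFintype _ l s).1 j)
      := by
    intro s
    rw [map_multiset_prod, Multiset.map_map, Finset.prod_multiset_map_count]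
    simp only [Function.comp_apply, MvPolynomial.aeval_X, Sym.coe_equivNatSumOfFintype_apply_apply]
    refine Finset.prod_subset (Finset.subset_univ _) fun j _ hj => ?_
    rw [Multiset.mem_toFinset, ← Multiset.count_eq_zero] at hj
    rw [hj, pow_zero]
  let _ : Fintype {k : Fin n → ℕ // ∑ i, k i = l} :=
    Fintype.ofEquiv _ (Sym.equivNatSumOfFintype (Fin n) l)
  rw [Finset.sum_congr rfl fun s _ => h1 s, Equiv.sum_comp (Sym.equivNatSumOfFintype (Fin n) l)
    fun k : {k : Fin n → ℕ // ∑ i, k i = l} =>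
      ∏ j, ((MvPolynomial.X j : MvPolynomial (Fin n) ℂ) ^ 2) ^ k.1 j]
  refine (Finset.sum_subtype _ (fun k => ?_) fun k : Fin n → ℕ => ∏ j,
    ((MvPolynomial.X j : MvPolynomial (Fin n) ℂ) ^ 2) ^ k j).symm
  simp [Finset.mem_piAntidiag]

/-- The generating function of the traces of the diagrams with `b` horizontal bottom dots. -/
theorem sum_X_pow_mul_diagramTrace_eq (hn : 2 * n ≤ N) (l : ℕ) :
    ∑ d : BrauerDiagram (2 * l), (X : (MvPolynomial (Fin n) ℂ)[X]) ^ bottomCount d *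
        C (diagramTrace N n d) =
      ((2 * l).factorial : (MvPolynomial (Fin n) ℂ)[X]) * (1 - X ^ 2) ^ l *
        C (MvPolynomial.aeval
          (fun i : Fin n => (MvPolynomial.X i : MvPolynomial (Fin n) ℂ) ^ 2)
          (MvPolynomial.hsymm (Fin n) ℂ l)) := by
  rw [sum_X_pow_mul_diagramTrace, sum_cartanEntry hn, Wick.expect_sum_pairForm_pow X]
  · rw [aeval_sq_hsymm]
    simp only [map_sum, map_prod, map_pow]
  · intro i j h
    simpa [positiveLabel, Fin.ext_iff] using h
  · intro i j h
    simp only [positiveLabel, Fin.ext_iff, Fin.val_rev] at h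
    omega

/-- The trace of a combination of diagrams whose coefficients depend on the number of horizontal
edges. -/
theorem sum_mul_diagramTrace (hn : 2 * n ≤ N) (l : ℕ) (φ : ℕ → ℂ) :
    ∑ d : BrauerDiagram (2 * l), MvPolynomial.C (φ (bottomCount d)) * diagramTrace N n d =
      MvPolynomial.C (∑ r ∈ Finset.range (l + 1),
        ((2 * l).factorial : ℂ) * (l.choose r : ℂ) * (-1) ^ r * φ (2 * r)) *
        MvPolynomial.aeval
          (fun i : Fin n => (MvPolynomial.X i : MvPolynomial (Fin n) ℂ) ^ 2)
          (MvPolynomial.hsymm (Fin n) ℂ l) := by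
  -- the linear map that replaces the `b`-th power of the variable by the number `φ b`
  let Φ : (MvPolynomial (Fin n) ℂ)[X] →ₗ[MvPolynomial (Fin n) ℂ] MvPolynomial (Fin n) ℂ :=
    Polynomial.lsum fun b => LinearMap.toSpanSingleton _ _ (MvPolynomial.C (φ b))
  have hΦ : ∀ (a : MvPolynomial (Fin n) ℂ) (b : ℕ), Φ (C a * X ^ b) = a * MvPolynomial.C (φ b) := by
    intro a b
    rw [C_mul_X_pow_eq_monomial]
    change Polynomial.sum _ _ = _
    rw [sum_monomial_index _ _ (by simp)]
    simp
  have h := congrArg Φ (sum_X_pow_mul_diagramTrace_eq hn l)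
  set H := MvPolynomial.aeval (fun i : Fin n => (MvPolynomial.X i : MvPolynomial (Fin n) ℂ) ^ 2)
    (MvPolynomial.hsymm (Fin n) ℂ l)
  have hbin : ((2 * l).factorial : (MvPolynomial (Fin n) ℂ)[X]) * (1 - X ^ 2) ^ l * C H =
      ∑ r ∈ Finset.range (l + 1), C (((2 * l).factorial : MvPolynomial (Fin n) ℂ) *
        (l.choose r : MvPolynomial (Fin n) ℂ) * (-1) ^ r * H) * X ^ (2 * r) := by
    rw [sub_eq_neg_add, add_pow, Finset.mul_sum, Finset.sum_mul]
    refine Finset.sum_congr rfl fun r _ => ?_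
    rw [neg_pow]
    simp only [map_mul, map_natCast, map_pow, map_neg, map_one, one_pow]
    ring
  rw [hbin, map_sum, map_sum] at h
  simp only [hΦ, mul_comm (X ^ _) (C _)] at h
  rw [map_sum, Finset.sum_mul]
  simp only [mul_comm (MvPolynomial.C (φ _)) (diagramTrace _ _ _)]
  rw [h]
  refine Finset.sum_congr rfl fun r _ => ?_
  simp only [map_mul, map_natCast, map_pow, map_neg, map_one]
  ring

end Trace

/-- A telescoping evaluation of the sum of quotients of the binomial coefficients of `l` and of
`N/2 + 2l - 2` over `r`. -/
lemma sum_choose_mul_symmetrizerCoeff {N l : ℕ} (hN : 1 ≤ N) (hl : 1 ≤ l) :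
    ∑ r ∈ Finset.range (l + 1), ((2 * l).factorial : ℂ) * (l.choose r : ℂ) * (-1) ^ r *
        symmetrizerCoeff (N : ℂ) (2 * l) (2 * r) =
      ((N : ℂ) + 4 * l - 2) / ((N : ℂ) + 2 * l - 2) := by
  have hfac : ((2 * l).factorial : ℂ) ≠ 0 := by exact_mod_cast (2 * l).factorial_ne_zero
  have hden : (N : ℂ) + 2 * l - 2 ≠ 0 := by
    have : ((N + 2 * l - 2 : ℕ) : ℂ) ≠ 0 := by
      rw [Nat.cast_ne_zero]
      omega
    rw [Nat.cast_sub (by omega)] at this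
    push_cast at this
    exact this
  set a : ℕ → ℂ := fun r => ((2 * l).factorial : ℂ) * (l.choose r : ℂ) * (-1) ^ r *
    symmetrizerCoeff (N : ℂ) (2 * l) (2 * r) with ha
  have h0 : a 0 = 1 := by
    simp [ha, symmetrizerCoeff, hfac]
  have hstep : ∀ r, r < l → (N + 4 * l - 4 - 2 * r) * a (r + 1) = 2 * (l - r) * a r := by
    intro r hr
    have h1 : (N : ℂ) + 2 * (2 * l : ℕ) - 4 - (2 * r : ℕ) ≠ 0 := by
      have : ((N + 2 * (2 * l) - 4 - 2 * r : ℕ) : ℂ) ≠ 0 := by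
        rw [Nat.cast_ne_zero]
        omega
      rw [Nat.cast_sub (by omega), Nat.cast_sub (by omega)] at this
      push_cast at this ⊢
      exact this
    have h2 := symmetrizerCoeff_add_two h1
    have h3 : ((l.choose (r + 1) : ℕ) : ℂ) * (r + 1) = l.choose r * (l - r) := by
      have := Nat.choose_succ_right_eq l r
      rw [← Nat.cast_sub hr.le]
      exact_mod_cast this
    simp only [ha, show 2 * (r + 1) = 2 * r + 2 by ring, pow_succ]
    push_cast at h2 ⊢
    linear_combination -((2 * l).factorial : ℂ) * (l.choose (r + 1) : ℂ) * (-1) ^ r * h2 +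
      2 * ((2 * l).factorial : ℂ) * (-1) ^ r * symmetrizerCoeff (N : ℂ) (2 * l) (2 * r) * h3
  have hpartial : ∀ R, R ≤ l → (N + 2 * l - 2) * ∑ r ∈ Finset.range R, a r =
      (N + 4 * l - 2) - (N + 4 * l - 2 - 2 * R) * a R := by
    intro R
    induction R with
    | zero =>
      intro _
      simp [h0]
    | succ R ih =>
      intro hR
      rw [Finset.sum_range_succ, mul_add, ih (by omega)]
      have := hstep R (by omega)
      push_cast
      linear_combination this
  rw [eq_div_iff hden, mul_comm, Finset.sum_range_succ, mul_add, hpartial l le_rfl]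
  ring

section Specialization

/-- The value of a rational function can be computed from any representation as a fraction whose
denominator does not vanish. -/
lemma ratFunc_eval_div {p q : ℂ[X]} {z : ℂ} (hq : q.eval z ≠ 0) :
    (algebraMap ℂ[X] (RatFunc ℂ) p / algebraMap ℂ[X] (RatFunc ℂ) q).denom.eval z ≠ 0 ∧
    (algebraMap ℂ[X] (RatFunc ℂ) p / algebraMap ℂ[X] (RatFunc ℂ) q).eval (RingHom.id ℂ) z =
      p.eval z / q.eval z := by
  set x := algebraMap ℂ[X] (RatFunc ℂ) p / algebraMap ℂ[X] (RatFunc ℂ) q with hx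
  have hq0 : q ≠ 0 := by
    rintro rfl
    simp at hq
  have h1 : x.denom.eval z ≠ 0 := by
    intro h
    obtain ⟨r, hr⟩ := RatFunc.denom_div_dvd p q
    rw [← hx] at hr
    rw [hr, eval_mul, h, zero_mul] at hq
    exact hq rfl
  refine ⟨h1, ?_⟩
  have h2 := congrArg (Polynomial.eval z) ((RatFunc.num_mul_eq_mul_denom_iff hq0).2 hx)
  rw [eval_mul, eval_mul] at h2
  rw [RatFunc.eval, ← Polynomial.eval, ← Polynomial.eval, div_eq_div_iff h1 hq, h2]

lemma symmetrizerCoeff_eq_div {N m : ℕ} (hN : 1 ≤ N) (hm : 2 ≤ m) (b : ℕ) (hb : b ≤ m) :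
    ∃ p q : ℂ[X], q.eval (N : ℂ) ≠ 0 ∧
      symmetrizerCoeff (RatFunc.X : RatFunc ℂ) m b = algebraMap _ _ p / algebraMap _ _ q ∧
      symmetrizerCoeff (N : ℂ) m b = p.eval (N : ℂ) / q.eval (N : ℂ) := by
  induction b using Nat.twoStepInduction with
  | zero =>
    refine ⟨1, (m.factorial : ℂ[X]), ?_, ?_, ?_⟩
    · simpa using m.factorial_ne_zero
    · simp [symmetrizerCoeff]
    · simp [symmetrizerCoeff]
  | one => exact ⟨0, 1, by simp, by simp [symmetrizerCoeff], by simp [symmetrizerCoeff]⟩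
  | more b ih _ =>
    obtain ⟨p, q, hq, h1, h2⟩ := ih (by omega)
    have hden : (X + 2 * (m : ℂ[X]) - 4 - (b : ℂ[X])).eval (N : ℂ) ≠ 0 := by
      have : ((N + 2 * m - 4 - b : ℕ) : ℂ) ≠ 0 := by
        rw [Nat.cast_ne_zero]
        omega
      rw [Nat.cast_sub (by omega), Nat.cast_sub (by omega)] at this
      simpa using this
    refine ⟨-((b : ℂ[X]) + 2) * p, (X + 2 * (m : ℂ[X]) - 4 - (b : ℂ[X])) * q, ?_, ?_, ?_⟩
    · rw [eval_mul]
      exact mul_ne_zero hden hq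
    · rw [symmetrizerCoeff, h1, div_mul_div_comm]
      simp only [map_mul, map_neg, map_add, map_sub, map_natCast, map_ofNat, RatFunc.algebraMap_X]
    · rw [symmetrizerCoeff, h2, div_mul_div_comm]
      simp

lemma ratFunc_X_add_intCast_ne_zero (k : ℤ) : (RatFunc.X : RatFunc ℂ) + k ≠ 0 := by
  have h : (X + C (k : ℂ) : ℂ[X]) ≠ 0 := X_add_C_ne_zero _
  have h2 := RatFunc.algebraMap_ne_zero h
  rw [map_add, RatFunc.algebraMap_X] at h2
  simpa using h2

lemma symmetrizer_isRegularAt {N m : ℕ} (hN : 1 ≤ N) (hm : 2 ≤ m) :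
    IsRegularAt (N : ℂ) (symmetrizer (RatFunc.X : RatFunc ℂ) m) := by
  intro d
  have hb := card_top_isRight d
  obtain ⟨p, q, hq, h1, -⟩ := symmetrizerCoeff_eq_div hN hm (bottomCount d) (by omega)
  rw [symmetrizer, h1]
  exact (ratFunc_eval_div hq).1

lemma specialize_symmetrizer {N m : ℕ} (hN : 1 ≤ N) (hm : 2 ≤ m) :
    specialize (N : ℂ) (symmetrizer (RatFunc.X : RatFunc ℂ) m) = symmetrizer (N : ℂ) m := by
  funext d
  have hb := card_top_isRight d
  obtain ⟨p, q, hq, h1, h2⟩ := symmetrizerCoeff_eq_div hN hm (bottomCount d) (by omega)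
  rw [specialize, symmetrizer, symmetrizer, h1, h2]
  exact (ratFunc_eval_div hq).2

end Specialization

end BrauerAlgebra

end

theorem corollary4p3 (N n l : ℕ) (hN : 1 ≤ N) (hn : N = 2 * n ∨ N = 2 * n + 1) (hl : 1 ≤ l) :
    ∃ S : BrauerAlgebra (RatFunc ℂ) RatFunc.X (2 * l),
      BrauerAlgebra.IsSymmetrizer (2 * l) S ∧
      (∀ S', BrauerAlgebra.IsSymmetrizer (2 * l) S' → S' = S) ∧
      BrauerAlgebra.IsRegularAt (N : ℂ) S ∧
      BrauerAlgebra.characteristicMap N n (BrauerAlgebra.specialize (N : ℂ) S) =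
        MvPolynomial.C
            (((N : ℂ) + 4 * l - 2) / (((2 * l).factorial : ℂ) * ((N : ℂ) + 2 * l - 2))) *
          MvPolynomial.aeval (fun i : Fin n => (MvPolynomial.X i : MvPolynomial (Fin n) ℂ) ^ 2)
            (MvPolynomial.hsymm (Fin n) ℂ l) := by
  have : CharZero (RatFunc ℂ) :=
    charZero_of_injective_algebraMap (RatFunc.algebraMap_injective ℂ)
  have hS := BrauerAlgebra.isPrimitiveIdempotent_symmetrizer
    BrauerAlgebra.ratFunc_X_add_intCast_ne_zero (2 * l)
  refine ⟨_, hS, fun S' hS' => hS'.unique hS,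
    BrauerAlgebra.symmetrizer_isRegularAt hN (by omega), ?_⟩
  rw [BrauerAlgebra.specialize_symmetrizer hN (by omega), BrauerAlgebra.characteristicMap_eq]
  simp only [BrauerAlgebra.symmetrizer]
  rw [BrauerAlgebra.sum_mul_diagramTrace (by omega),
    BrauerAlgebra.sum_choose_mul_symmetrizerCoeff hN hl, ← mul_assoc, ← map_mul]
  congr 2
  rw [div_mul_div_comm, one_mul]
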